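/- Let $G=\mathbb{Z}^2\rtimes_\varphi\mathbb{Z}$ be any semidirect product, with $\varphi:\mathbb{Z}\to\mathrm{Aut}(\mathbb{Z}^2)$ an arbitrary homomorphism. Then $G$ admits an asynchronous combing that is an ET0L language. More precisely, let $t$ be a generator of the factor $\mathbb{Z}$, and let $v=(1,0)$ and $h=(0,1)$ be the standard generators of $\mathbb{Z}^2$. Then the language $$L_0=\bigl(t^*\cup(t^{-1})^*\bigr)L$$ over the alphabet $\Sigma=\{t^{\pm1},v^{\pm1},h^{\pm1}\}$ is an ET0L language and an asynchronous combing of $G$, where $L$ is the crossing-sequence language for $\mathbb{Z}^2$. The notions used here are the following. *Crossing sequences.* For integers $m>0$, $n\ge 0$ choose a real $n^+$ with $n<n^+<n+1$ such that the segment from $(0,0)$ to $(m,n^+)$ contains no lattice point except $(0,0)$ and the interior of the triangle with vertices $(0,0)$, $(m,n)$, $(m,n^+)$ contains no lattice point. Follow this segment from $(0,0)$ (excluded) to $(m,n^+)$ (included), and write $v$ whenever a vertical line $x=i$ and $h$ whenever a horizontal line $y=j$ ($i,j\in\mathbb{Z}$) is met. The resulting word is $\kappa(m,n)$; for example $\kappa(2,3)=hvhhv$.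 The language $L$ consists of the empty word, the words $\kappa(m,n)$ with $m>0$, $n\ge0$, and all words obtained from these by applying one, two or three times the letter substitution $v\mapsto h$, $h\mapsto v^{-1}$, $v^{-1}\mapsto h^{-1}$, $h^{-1}\mapsto v$ that corresponds to rotating the plane by a quarter turn. *Asynchronous combing.* A language $K\subseteq\Sigma^*$ is an asynchronous combing of $G$ if every element of $G$ is represented by exactly one word of $K$ and there is a constant $C$ such that for all $w,w'\in K$ representing elements at distance at most $1$ in the Cayley graph of $G$ (with edges joining $g$ to $gs$, $s\in\Sigma$) there are unbounded functions $\rho,\rho':\mathbb{N}\to\mathbb{N}$ with $\rho(0)=\rho'(0)=0$ and $\rho(i+1)-\rho(i),\ \rho'(i+1)-\rho'(i)\in\{0,1\}$ for all $i$, such that $d\bigl(w(\rho(i)),w'(\rho'(i))\bigr)\le C$ for all $i$. Here $d$ is the Cayley graph distance and $w(j)$ is the element represented by the prefix of $w$ of length $j$ (by $w$ itself if $j$ exceeds its length). *ET0L language.* An ET0L system over a finite alphabet $A$ consists of a finite alphabet $V\supseteq A$, a finite set of tables, each a finite subset of $V\times V^*$, and a finite set $I\subseteq V^*$ of axioms.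 A table $\theta$ rewrites $c_1\cdots c_k$ (with $c_i\in V$) to $v_1\cdots v_k$ (with $v_i\in V^*$) if for each $i$ either $(c_i,v_i)\in\theta$, or $\theta$ contains no pair with first entry $c_i$ and $v_i=c_i$. A language over $A$ is ET0L if it is the set of all words in $A^*$ obtainable from some axiom by finitely many rewritings, each by some table of such a system. -/

import Mathlib

/-! ### ET0L systems -/

/-- An ET0L system with terminal alphabet `A`: a finite alphabet `V` containing `A` (via `terminal`),
a finite set of tables (finite subsets of `V × V*`), and a finite set of axioms in `V*`. -/
structure ET0LSystem (A : Type) where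
  V : Type
  finite_V : Finite V
  terminal : A ↪ V
  tables : Finset (Finset (V × List V))
  axiomWords : Finset (List V)

namespace ET0LSystem

/-- `c ⟶ w` by the table `t`; a letter for which `t` lists no rule is kept unchanged. -/
def Rule {V : Type} (t : Finset (V × List V)) (c : V) (w : List V) : Prop :=
  (c, w) ∈ t ∨ ((∀ w', (c, w') ∉ t) ∧ w = [c])

/-- Parallel rewriting by a table: every letter occurrence of `u` is replaced, each by some rule
for that letter. -/
def TableStep {V : Type} (t : Finset (V × List V)) (u v : List V) : Prop :=
  ∃ ws : List (List V), List.Forall₂ (Rule t) u ws ∧ v = ws.flatten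

/-- One rewriting step, by any table of the system. -/
def Step {A : Type} (H : ET0LSystem A) (u v : List H.V) : Prop :=
  ∃ t ∈ H.tables, TableStep t u v

/-- The terminal words derivable from an axiom. -/
def language {A : Type} (H : ET0LSystem A) : Language A :=
  {w : List A | ∃ i ∈ H.axiomWords, Relation.ReflTransGen H.Step i (w.map H.terminal)}

end ET0LSystem

/-- A language is ET0L if it is generated by some ET0L system. -/
def IsET0L {A : Type} (L : Language A) : Prop :=
  ∃ H : ET0LSystem A, H.language = L

/-! ### Asynchronous combings

A choice of generators is a family `gen : ι → G` indexed by a finite type; words are written in the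
alphabet `ι × Bool`, where `(a, true)` stands for the generator `a` and `(a, false)` for its
formal inverse. -/

section Combing

variable {G : Type} [Group G] {ι : Type}

/-- The group element represented by a letter. -/
def letterValue (gen : ι → G) (x : ι × Bool) : G :=
  if x.2 then gen x.1 else (gen x.1)⁻¹

/-- The group element represented by a word. -/
def wordValue (gen : ι → G) (w : List (ι × Bool)) : G :=
  (w.map (letterValue gen)).prod

/-- `g` and `g'` are at distance at most `k` in the Cayley graph (with edges `g — g * s`). -/
def CayleyDistLE (gen : ι → G) (k : ℕ) (g g' : G) : Prop :=
  ∃ u : List (ι × Bool), u.length ≤ k ∧ g * wordValue gen u = g'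

/-- The vertex reached at time `n` by the path of the word `w` from `1` in the Cayley graph; it is
constant after the end of `w`. -/
def pathVertex (gen : ι → G) (w : List (ι × Bool)) (n : ℕ) : G :=
  wordValue gen (w.take n)

/-- Discrete reparametrizations: they start at `0`, advance by `0` or `1` at each step, and are
unbounded. -/
def IsReparametrization (ρ : ℕ → ℕ) : Prop :=
  ρ 0 = 0 ∧ (∀ n, ρ (n + 1) = ρ n ∨ ρ (n + 1) = ρ n + 1) ∧ ∀ N, ∃ n, N ≤ ρ n

/-- The paths of `w` and `w'` asynchronously `K`-fellow-travel. -/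
def AsyncFellowTravel (gen : ι → G) (K : ℕ) (w w' : List (ι × Bool)) : Prop :=
  ∃ ρ ρ' : ℕ → ℕ, IsReparametrization ρ ∧ IsReparametrization ρ' ∧
    ∀ n, CayleyDistLE gen K (pathVertex gen w (ρ n)) (pathVertex gen w' (ρ' n))

/-- `L` is an asynchronous combing of `G`: a set of normal forms (each element of `G` is represented
by exactly one word of `L`) with the asynchronous fellow-traveler property. -/
structure IsAsynchronousCombing (gen : ι → G) (L : Language (ι × Bool)) : Prop where
  finite_generators : Finite ι
  normal_forms : Set.BijOn (wordValue gen) {w | w ∈ L} Set.univ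
  fellow_traveler : ∃ K : ℕ, ∀ w ∈ L, ∀ w' ∈ L,
    CayleyDistLE gen 1 (wordValue gen w) (wordValue gen w') → AsyncFellowTravel gen K w w'

end Combing

/-! ### Crossing sequences -/

/-- The generator symbols: `t` for the factor `ℤ`; `v` (a vertical line is crossed, a step `(1,0)`)
and `h` (a horizontal line is crossed, a step `(0,1)`) for `ℤ²`. -/
inductive GenSymbol
  | t | v | h

/-- The real number `p` is slightly larger than `n`, relative to `m`: the segment from the origin to
`(m, p)` has no lattice point but the origin, and there is none in the interior of the triangle with
vertices `(0,0)`, `(m,n)`, `(m,p)`. -/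
structure IsSlightlyLarger (m n : ℤ) (p : ℝ) : Prop where
  lt : (n : ℝ) < p
  lt_add_one : p < n + 1
  segment_lattice : ∀ i j : ℤ,
    ((i : ℝ), (j : ℝ)) ∈ segment ℝ ((0 : ℝ), (0 : ℝ)) ((m : ℝ), p) → i = 0 ∧ j = 0
  triangle_lattice : ∀ i j : ℤ, ((i : ℝ), (j : ℝ)) ∉
    interior (convexHull ℝ {((0 : ℝ), (0 : ℝ)), ((m : ℝ), (n : ℝ)), ((m : ℝ), p)})

/-- The point `(s * m, s * p)` of the segment from the origin to `(m, p)` lies on an integral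
vertical line (for `v`), on an integral horizontal line (for `h`). -/
def CrossesAt (m : ℤ) (p s : ℝ) : GenSymbol → Prop
  | .t => False
  | .v => ∃ i : ℤ, s * m = i
  | .h => ∃ j : ℤ, s * p = j

/-- `w` is the crossing sequence `κ(m, n)`: for `p` slightly larger than `n`, the crossings of the
segment from the origin (excluded) to `(m, p)` (included), recorded in order. -/
def IsCrossingSequence (m n : ℤ) (w : List GenSymbol) : Prop :=
  ∃ p : ℝ, IsSlightlyLarger m n p ∧ ∃ e : List (ℝ × GenSymbol),
    e.Pairwise (fun c d => c.1 < d.1) ∧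
    (∀ c, c ∈ e ↔ 0 < c.1 ∧ c.1 ≤ 1 ∧ CrossesAt m p c.1 c.2) ∧
    w = e.map Prod.snd

/-- The effect on letters of the rotation of the plane by a quarter turn:
`v ↦ h`, `h ↦ v⁻¹`. -/
def rotateLetter : GenSymbol × Bool → GenSymbol × Bool
  | (.t, b) => (.t, b)
  | (.v, b) => (.h, b)
  | (.h, b) => (.v, !b)

/-- The crossing-sequence language for `ℤ²`: the empty word for `(0,0)`, the words `κ(m, n)` for
`m > 0`, `n ≥ 0`, and their images under the rotations by multiples of a quarter turn, which carry
this quadrant onto the rest of `ℤ²` without the origin. -/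
def crossingLanguage : Language (GenSymbol × Bool) :=
  {w : List (GenSymbol × Bool) | w = [] ∨ ∃ (m n : ℤ) (u : List GenSymbol) (k : Fin 4),
    0 < m ∧ 0 ≤ n ∧ IsCrossingSequence m n u ∧
    w = (u.map fun a => (a, true)).map (rotateLetter^[(k : ℕ)])}

/-! ### Semidirect products -/

/-- The elements of `ℤ² ⋊ ℤ` named by the symbols, for a generator `τ` of `ℤ`. -/
def semidirectGen (φ : Multiplicative ℤ →* MulAut (Multiplicative (ℤ × ℤ)))
    (τ : Multiplicative ℤ) : GenSymbol → Multiplicative (ℤ × ℤ) ⋊[φ] Multiplicative ℤ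
  | .t => SemidirectProduct.inr τ
  | .v => SemidirectProduct.inl (Multiplicative.ofAdd ((1, 0) : ℤ × ℤ))
  | .h => SemidirectProduct.inl (Multiplicative.ofAdd ((0, 1) : ℤ × ℤ))

/-- The language `(t* ∪ (t⁻¹)*) L`, where `L` is the crossing-sequence language. -/
def semidirectLanguage : Language (GenSymbol × Bool) :=
  (KStar.kstar ({[(GenSymbol.t, true)]} : Language (GenSymbol × Bool)) +
    KStar.kstar ({[(GenSymbol.t, false)]} : Language (GenSymbol × Bool))) * crossingLanguage

/-!
The crossing sequence `κ(m, n)` has a purely combinatorial description: at the lattice point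
`(i, j)` put `d = i * n - j * m`; the next line met is horizontal exactly if `m ≤ d + n`
(`isCrossingSequence_iff_isDigitalWord`; the empty triangle in the definition of `κ` is what makes
the answer independent of the chosen real number slightly larger than `n`). The state `d` is
invariant under the shears `(x, y) ↦ (x, y + x)` and `(x, y) ↦ (x + y, y)`, which act on these words
by the substitutions `v ↦ hv` and `h ↦ vh`. By the subtractive Euclidean algorithm, the words
`κ(m, n)` are therefore exactly the words obtained from nonempty powers of `v` by these two
substitutions (`exists_shearGenerated_isDigitalWord`).

This description gives an ET0L system at once: one table produces powers of `v`, two tables perform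
the substitutions, four tables rotate and make the letters terminal, and one table produces the
prefix `t ^ e`. Each table has exactly one rule for each letter, so that a rewriting step is the
application of a monoid endomorphism (`combingSystem_step`).

For the combing, the state `d` stays in an interval of length `m + n`, the length of `κ(m, n)`. So
the path of `κ(m, n)`, traversed at constant speed, stays within a bounded distance of the straight
segment, also traversed at constant speed (`isStraight_of_mem_crossingLanguage`). A linear map
carries segments to segments; hence words whose endpoints correspond up to distance `1` under a
fixed linear map have paths that correspond up to bounded distance
(`exists_reparametrization_of_isStraight`). The identity map is used for neighbours `g`, `g v^±1` or
`g h^±1`, and conjugation by `t^±1` is used for neighbours `g` and `g t^±1`.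
-/

/-! ### Digital words and shears -/

/-- The displacement in `ℤ²` of a positive letter. -/
def symbolStep : GenSymbol → ℤ × ℤ
  | .t => (0, 0)
  | .v => (1, 0)
  | .h => (0, 1)

/-- The endpoint of the lattice path of a positive word. -/
def symbolSum (w : List GenSymbol) : ℤ × ℤ :=
  (w.map symbolStep).sum

@[simp] theorem symbolSum_nil : symbolSum [] = 0 := rfl

@[simp] theorem symbolSum_cons (a : GenSymbol) (w : List GenSymbol) :
    symbolSum (a :: w) = symbolStep a + symbolSum w := by
  simp [symbolSum]

/-- `w` can be read by the greedy process that approximates the line of slope `n / m` just from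
above. At the lattice point `(i, j)` the state is `d = i * n - j * m`; the next crossing of the line
is the horizontal one exactly if `(j + 1) * m ≤ (i + 1) * n`, that is, `m ≤ d + n`. -/
def FollowsSlope (m n : ℤ) : ℤ → List GenSymbol → Prop
  | _, [] => True
  | _, .t :: _ => False
  | d, .v :: w => d + n < m ∧ FollowsSlope m n (d + n) w
  | d, .h :: w => m ≤ d + n ∧ FollowsSlope m n (d - m) w

/-- The digital word from the origin to `(m, n)`: the combinatorial description of `κ(m, n)`. -/
def IsDigitalWord (m n : ℤ) (w : List GenSymbol) : Prop :=
  FollowsSlope m n 0 w ∧ symbolSum w = (m, n)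

theorem FollowsSlope.length_eq {m n : ℤ} :
    ∀ {w : List GenSymbol} {d : ℤ}, FollowsSlope m n d w →
      (w.length : ℤ) = (symbolSum w).1 + (symbolSum w).2
  | [], _, _ => by simp
  | .t :: _, _, h => h.elim
  | .v :: w, d, h => by
    have := FollowsSlope.length_eq h.2
    simp only [List.length_cons, symbolSum_cons, symbolStep, Prod.fst_add, Prod.snd_add]
    push_cast
    omega
  | .h :: w, d, h => by
    have := FollowsSlope.length_eq h.2
    simp only [List.length_cons, symbolSum_cons, symbolStep, Prod.fst_add, Prod.snd_add]
    push_cast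
    omega

theorem FollowsSlope.not_mem_t {m n : ℤ} :
    ∀ {w : List GenSymbol} {d : ℤ}, FollowsSlope m n d w → GenSymbol.t ∉ w
  | [], _, _ => by simp
  | .t :: _, _, h => h.elim
  | .v :: w, d, h => by simpa using FollowsSlope.not_mem_t h.2
  | .h :: w, d, h => by simpa using FollowsSlope.not_mem_t h.2

theorem FollowsSlope.take {m n : ℤ} :
    ∀ {w : List GenSymbol} {d : ℤ}, FollowsSlope m n d w → ∀ k, FollowsSlope m n d (w.take k)
  | _, _, _, 0 => trivial
  | [], _, _, _ + 1 => trivial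
  | .t :: _, _, h, _ + 1 => h.elim
  | .v :: _, _, h, k + 1 => ⟨h.1, FollowsSlope.take h.2 k⟩
  | .h :: _, _, h, k + 1 => ⟨h.1, FollowsSlope.take h.2 k⟩

/-- The greedy process is deterministic. -/
theorem FollowsSlope.eq_of_length_eq {m n : ℤ} :
    ∀ {w w' : List GenSymbol} {d : ℤ}, FollowsSlope m n d w → FollowsSlope m n d w' →
      w.length = w'.length → w = w'
  | [], [], _, _, _, _ => rfl
  | [], _ :: _, _, _, _, hl => by simp at hl
  | _ :: _, [], _, _, _, hl => by simp at hl
  | .t :: _, _ :: _, _, h, _, _ => h.elim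
  | _ :: _, .t :: _, _, _, h, _ => h.elim
  | .v :: _, .h :: _, _, h, h', _ => absurd h.1 (not_lt.2 h'.1)
  | .h :: _, .v :: _, _, h, h', _ => absurd h'.1 (not_lt.2 h.1)
  | .v :: _, .v :: _, _, h, h', hl => by
    rw [FollowsSlope.eq_of_length_eq h.2 h'.2 (by simpa using hl)]
  | .h :: _, .h :: _, _, h, h', hl => by
    rw [FollowsSlope.eq_of_length_eq h.2 h'.2 (by simpa using hl)]

theorem IsDigitalWord.unique {m n : ℤ} {w w' : List GenSymbol} (h : IsDigitalWord m n w)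
    (h' : IsDigitalWord m n w') : w = w' := by
  refine h.1.eq_of_length_eq h'.1 ?_
  have e := h.1.length_eq
  have e' := h'.1.length_eq
  rw [h.2] at e
  rw [h'.2] at e'
  omega

/-- The state stays in a window of length `m + n`. -/
theorem FollowsSlope.state_bounds {m n : ℤ} (hm : 0 ≤ m) (hn : 0 ≤ n) :
    ∀ {w : List GenSymbol} {d : ℤ}, FollowsSlope m n d w → -n ≤ d → d < m → ∀ k : ℕ,
      -n ≤ d + (symbolSum (w.take k)).1 * n - (symbolSum (w.take k)).2 * m ∧
        d + (symbolSum (w.take k)).1 * n - (symbolSum (w.take k)).2 * m < m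
  | _, _, _, h₁, h₂, 0 => by simp [h₁, h₂]
  | [], _, _, h₁, h₂, _ + 1 => by simp [h₁, h₂]
  | .t :: _, _, h, _, _, _ + 1 => h.elim
  | .v :: w, d, h, h₁, h₂, k + 1 => by
    have := FollowsSlope.state_bounds hm hn h.2 (by omega) h.1 k
    simp only [List.take_succ_cons, symbolSum_cons, symbolStep, Prod.fst_add, Prod.snd_add]
    constructor <;> linarith [this.1, this.2]
  | .h :: w, d, h, h₁, h₂, k + 1 => by
    have := FollowsSlope.state_bounds hm hn h.2 (by have := h.1; omega) (by omega) k
    simp only [List.take_succ_cons, symbolSum_cons, symbolStep, Prod.fst_add, Prod.snd_add]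
    constructor <;> linarith [this.1, this.2]

/-- The effect on crossing sequences of the two elementary shears of the plane: `v ↦ hv` for
`(x, y) ↦ (x, y + x)`, and `h ↦ vh` for `(x, y) ↦ (x + y, y)`. -/
def shearLetter : Bool → GenSymbol → List GenSymbol
  | true, .v => [.h, .v]
  | false, .h => [.v, .h]
  | _, a => [a]

theorem symbolSum_flatMap_shearLetter_true (w : List GenSymbol) :
    symbolSum (w.flatMap (shearLetter true)) =
      ((symbolSum w).1, (symbolSum w).2 + (symbolSum w).1) := by
  induction w with
  | nil => rfl
  | cons a w ih => cases a <;> ext <;> simp [ih, shearLetter, symbolStep] <;> ring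

theorem symbolSum_flatMap_shearLetter_false (w : List GenSymbol) :
    symbolSum (w.flatMap (shearLetter false)) =
      ((symbolSum w).1 + (symbolSum w).2, (symbolSum w).2) := by
  induction w with
  | nil => rfl
  | cons a w ih => cases a <;> ext <;> simp [ih, shearLetter, symbolStep] <;> ring

/-- The shear `(x, y) ↦ (x, y + x)` preserves the state `i * n - j * m`. -/
theorem FollowsSlope.shear_true {m n : ℤ} (hm : 0 < m) (hn : 0 ≤ n) :
    ∀ {w : List GenSymbol} {d : ℤ}, FollowsSlope m n d w → -n ≤ d → d < m →
      FollowsSlope m (n + m) d (w.flatMap (shearLetter true))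
  | [], _, _, _, _ => trivial
  | .t :: _, _, h, _, _ => h.elim
  | .v :: w, d, h, h₁, h₂ => by
    refine ⟨by omega, by have := h.1; omega, ?_⟩
    rw [show d - m + (n + m) = d + n by ring]
    exact FollowsSlope.shear_true hm hn h.2 (by omega) h.1
  | .h :: w, d, h, h₁, h₂ =>
    ⟨by have := h.1; omega,
      FollowsSlope.shear_true hm hn h.2 (by have := h.1; omega) (by omega)⟩

/-- The shear `(x, y) ↦ (x + y, y)` preserves the state `i * n - j * m`. -/
theorem FollowsSlope.shear_false {m n : ℤ} (hm : 0 < m) (hn : 0 ≤ n) :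
    ∀ {w : List GenSymbol} {d : ℤ}, FollowsSlope m n d w → -n ≤ d → d < m →
      FollowsSlope (m + n) n d (w.flatMap (shearLetter false))
  | [], _, _, _, _ => trivial
  | .t :: _, _, h, _, _ => h.elim
  | .v :: w, d, h, h₁, h₂ =>
    ⟨by omega, FollowsSlope.shear_false hm hn h.2 (by omega) h.1⟩
  | .h :: w, d, h, h₁, h₂ => by
    refine ⟨by omega, by have := h.1; omega, ?_⟩
    rw [show d + n - (m + n) = d - m by ring]
    exact FollowsSlope.shear_false hm hn h.2 (by have := h.1; omega) (by omega)

theorem IsDigitalWord.shear_true {m n : ℤ} (hm : 0 < m) (hn : 0 ≤ n) {w : List GenSymbol}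
    (h : IsDigitalWord m n w) : IsDigitalWord m (n + m) (w.flatMap (shearLetter true)) :=
  ⟨h.1.shear_true hm hn (by omega) hm, by rw [symbolSum_flatMap_shearLetter_true, h.2]⟩

theorem IsDigitalWord.shear_false {m n : ℤ} (hm : 0 < m) (hn : 0 ≤ n) {w : List GenSymbol}
    (h : IsDigitalWord m n w) : IsDigitalWord (m + n) n (w.flatMap (shearLetter false)) :=
  ⟨h.1.shear_false hm hn (by omega) hm, by rw [symbolSum_flatMap_shearLetter_false, h.2]⟩

theorem isDigitalWord_replicate {g : ℕ} (hg : 0 < g) :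
    IsDigitalWord g 0 (List.replicate g .v) := by
  have h₁ : ∀ k : ℕ, FollowsSlope g 0 0 (List.replicate k .v) := by
    intro k
    induction k with
    | zero => trivial
    | succ k ih => exact ⟨by omega, by simpa using ih⟩
  refine ⟨h₁ g, ?_⟩
  ext <;> simp [symbolSum, symbolStep]

/-- The words obtained from the powers of `v` by shears. -/
inductive ShearGenerated : List GenSymbol → Prop
  | replicate (g : ℕ) : ShearGenerated (List.replicate g .v)
  | shear (b : Bool) {w : List GenSymbol} (h : ShearGenerated w) :
    ShearGenerated (w.flatMap (shearLetter b))

theorem ShearGenerated.eq_nil_or_isDigitalWord {w : List GenSymbol} (h : ShearGenerated w) :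
    w = [] ∨ ∃ m n : ℤ, 0 < m ∧ 0 ≤ n ∧ IsDigitalWord m n w := by
  induction h with
  | replicate g =>
    rcases Nat.eq_zero_or_pos g with rfl | hg
    · exact Or.inl rfl
    · exact Or.inr ⟨g, 0, by omega, le_rfl, isDigitalWord_replicate hg⟩
  | shear b _ ih =>
    rcases ih with rfl | ⟨m, n, hm, hn, hw⟩
    · exact Or.inl rfl
    · cases b
      · exact Or.inr ⟨m + n, n, by omega, hn, hw.shear_false hm hn⟩
      · exact Or.inr ⟨m, n + m, hm, by omega, hw.shear_true hm hn⟩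

/-- The subtractive Euclidean algorithm, run backwards, generates every digital word. -/
theorem exists_shearGenerated_isDigitalWord {m n : ℤ} (hm : 0 < m) (hn : 0 ≤ n) :
    ∃ w, ShearGenerated w ∧ IsDigitalWord m n w := by
  induction hN : (m + n).toNat using Nat.strong_induction_on generalizing m n with
  | _ N ih =>
    rcases hn.eq_or_lt with rfl | hn'
    · lift m to ℕ using hm.le
      exact ⟨_, .replicate m, isDigitalWord_replicate (by omega)⟩
    · rcases le_or_gt m n with hmn | hmn
      · obtain ⟨w, hw, hd⟩ := ih _ (by omega) hm (sub_nonneg.2 hmn) rfl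
        exact ⟨_, hw.shear true, by simpa using hd.shear_true hm (sub_nonneg.2 hmn)⟩
      · obtain ⟨w, hw, hd⟩ := ih _ (by omega) (sub_pos.2 hmn) hn rfl
        exact ⟨_, hw.shear false, by simpa using hd.shear_false (sub_pos.2 hmn) hn⟩

/-! ### Crossing sequences are digital words -/

/-- Below `p`, and above the slope `n / m`, there is no room for a lattice point. -/
theorem IsSlightlyLarger.mul_le {m n : ℤ} {p : ℝ} (h : IsSlightlyLarger m n p) (hn : 0 ≤ n)
    {i j : ℤ} (hi : 0 < i) (him : i ≤ m) (hj : (j : ℝ) * m < i * p) : j * m ≤ i * n := by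
  by_contra! hlt
  have hm : 0 < m := by omega
  have hmR : (0 : ℝ) < m := by exact_mod_cast hm
  have hiR : (0 : ℝ) < i := by exact_mod_cast hi
  have hnp := h.lt
  have hnR : (0 : ℝ) ≤ n := by exact_mod_cast hn
  rcases him.lt_or_eq with him | rfl
  · refine h.triangle_lattice i j ?_
    have hopen : IsOpen {q : ℝ × ℝ | q.1 < m ∧ q.1 * n < q.2 * m ∧ q.2 * m < q.1 * p} :=
      (isOpen_lt continuous_fst continuous_const).and
        ((isOpen_lt (f := fun q : ℝ × ℝ => q.1 * n) (g := fun q => q.2 * m)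
          (by fun_prop) (by fun_prop)).and
        (isOpen_lt (f := fun q : ℝ × ℝ => q.2 * m) (g := fun q => q.1 * p)
          (by fun_prop) (by fun_prop)))
    refine interior_maximal ?_ hopen
      ⟨show (i : ℝ) < m by exact_mod_cast him, show (i : ℝ) * n < j * m by exact_mod_cast hlt, hj⟩
    rintro ⟨x, y⟩ ⟨hx, hy, hy'⟩
    simp only at hx hy hy'
    have hd : 0 < p - n := sub_pos.2 hnp
    have hx0 : 0 < x := by
      by_contra! hx0
      nlinarith
    -- `(x, y)` is the combination of `(m, n)` and `(m, p)` with weights `x / m - b` and `b`.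
    have hb : 0 ≤ (y - x * n / m) / (p - n) := by
      refine div_nonneg (sub_nonneg.2 ?_) hd.le
      rw [div_le_iff₀ hmR]
      exact hy.le
    have hb' : (y - x * n / m) / (p - n) ≤ x / m := by
      rw [div_le_div_iff₀ hd hmR]
      have : (y - x * n / m) * m = y * m - x * n := by field_simp
      rw [this]
      linarith
    have hxm : x / m ≤ 1 := (div_le_one hmR).2 hx.le
    rw [mem_convexHull_iff]
    intro t ht hc
    have h0 : ((0 : ℝ), (0 : ℝ)) ∈ t := ht (by simp)
    have h1 : ((m : ℝ), (n : ℝ)) ∈ t := ht (by simp)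
    have h2 : ((m : ℝ), p) ∈ t := ht (by simp)
    set b := (y - x * n / m) / (p - n) with hbdef
    have hbm : b * (p - n) = y - x * n / m := div_mul_cancel₀ _ hd.ne'
    have hc' := hc.sum_mem (t := Finset.univ) (w := ![1 - x / m, x / m - b, b])
      (z := ![((0 : ℝ), (0 : ℝ)), ((m : ℝ), (n : ℝ)), ((m : ℝ), p)])
      (by intro i _; fin_cases i <;> simp <;> linarith)
      (by simp [Fin.sum_univ_three])
      (by intro i _; fin_cases i <;> simp [h0, h1, h2])
    convert hc' using 1
    simp only [Fin.sum_univ_three, Matrix.cons_val, Prod.smul_mk, smul_eq_mul,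
      Prod.mk_add_mk, Prod.mk.injEq]
    constructor
    · field_simp
      ring
    · have : x / m * n = x * n / m := by ring
      linarith
  · have h₁ : (j : ℝ) < p := by
      by_contra! hle
      nlinarith
    have h₂ : (j : ℝ) < (n + 1 : ℤ) := by
      push_cast
      linarith [h.lt_add_one]
    have h₃ : j < n + 1 := by exact_mod_cast h₂
    nlinarith

/-- Reading the events of the segment from the point where `i` vertical and `j` horizontal lines
have been met. -/
theorem followsSlope_of_events {m n : ℤ} {p : ℝ} (hm : 0 < m) (hn : 0 ≤ n)
    (hp : IsSlightlyLarger m n p) :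
    ∀ (e : List (ℝ × GenSymbol)) (i j : ℤ), 0 ≤ i → 0 ≤ j → i ≤ m → j ≤ n →
      e.Pairwise (fun c d => c.1 < d.1) →
      (∀ c, c ∈ e ↔ (∃ k : ℤ, i < k ∧ k ≤ m ∧ c = ((k : ℝ) / m, .v)) ∨
        ∃ k : ℤ, j < k ∧ k ≤ n ∧ c = ((k : ℝ) / p, .h)) →
      FollowsSlope m n (i * n - j * m) (e.map Prod.snd) ∧
        symbolSum (e.map Prod.snd) = (m - i, n - j) := by
  have hmR : (0 : ℝ) < m := by exact_mod_cast hm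
  have hnR : (0 : ℝ) ≤ n := by exact_mod_cast hn
  have hpR : 0 < p := by linarith [hp.lt]
  intro e
  induction e with
  | nil =>
    intro i j _ _ him hjn _ he
    have hi : i = m := by
      by_contra hne
      simpa using (he ((m : ℝ) / m, .v)).2 (Or.inl ⟨m, by omega, le_rfl, rfl⟩)
    have hj : j = n := by
      by_contra hne
      simpa using (he ((n : ℝ) / p, .h)).2 (Or.inr ⟨n, by omega, le_rfl, rfl⟩)
    subst hi hj
    exact ⟨trivial, by simp; rfl⟩
  | cons c e ih =>
    intro i j hi hj him hjn hs he
    obtain ⟨hmin, hs'⟩ := List.pairwise_cons.1 hs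
    have hnot : ∀ d ∈ e, d ≠ c := fun d hd h => (hmin d hd).ne (by rw [h])
    rcases (he c).1 (by simp) with ⟨k, hik, hkm, rfl⟩ | ⟨k, hjk, hkn, rfl⟩
    · have hk : k = i + 1 := by
        by_contra hne
        have hmem := (he (((i + 1 : ℤ) : ℝ) / m, .v)).2 (Or.inl ⟨i + 1, by omega, by omega, rfl⟩)
        have hlt : ((i + 1 : ℤ) : ℝ) / m < (k : ℝ) / m :=
          div_lt_div_of_pos_right (by exact_mod_cast (by omega : i + 1 < k)) hmR
        rcases List.mem_cons.1 hmem with h | h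
        · exact hlt.ne (congrArg Prod.fst h)
        · exact hlt.not_gt (hmin _ h)
      subst hk
      have key : (i + 1) * n < (j + 1) * m := by
        rcases hjn.lt_or_eq with hjn' | rfl
        · have hmem := (he (((j + 1 : ℤ) : ℝ) / p, .h)).2
            (Or.inr ⟨j + 1, by omega, by omega, rfl⟩)
          rcases List.mem_cons.1 hmem with h | h
          · exact absurd (congrArg Prod.snd h) (by simp)
          · have := hmin _ h
            rw [div_lt_div_iff₀ hmR hpR] at this
            have hi1 : (0 : ℝ) < (i + 1 : ℤ) := by exact_mod_cast (by omega : 0 < i + 1)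
            have : ((i + 1 : ℤ) : ℝ) * n < (j + 1 : ℤ) * m := by nlinarith [hp.lt]
            exact_mod_cast this
        · nlinarith
      have := ih (i + 1) j (by omega) hj hkm hjn hs' fun d => by
        constructor
        · intro hd
          rcases (he d).1 (List.mem_cons_of_mem _ hd) with ⟨l, h₁, h₂, rfl⟩ | h
          · refine Or.inl ⟨l, lt_of_le_of_ne (by omega) ?_, h₂, rfl⟩
            rintro rfl
            exact hnot _ hd rfl
          · exact Or.inr h
        · intro h
          have hd : d ∈ ((((i + 1 : ℤ) : ℝ) / m, GenSymbol.v) :: e) := by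
            refine (he d).2 (h.imp_left ?_)
            rintro ⟨l, h₁, h₂, rfl⟩
            exact ⟨l, by omega, h₂, rfl⟩
          rcases List.mem_cons.1 hd with rfl | hd
          · rcases h with ⟨l, h₁, h₂, h₃⟩ | ⟨l, h₁, h₂, h₃⟩
            · have h₃ := congrArg Prod.fst h₃
              rw [div_left_inj' hmR.ne'] at h₃
              have h₃ : i + 1 = l := by exact_mod_cast h₃
              omega
            · simp at h₃
          · exact hd
      refine ⟨⟨by linarith, ?_⟩, ?_⟩
      · rw [show i * n - j * m + n = (i + 1) * n - j * m by ring]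
        exact this.1
      · simp only [List.map_cons, symbolSum_cons, this.2, symbolStep]
        ext <;> simp; ring
    · have hk : k = j + 1 := by
        by_contra hne
        have hmem := (he (((j + 1 : ℤ) : ℝ) / p, .h)).2 (Or.inr ⟨j + 1, by omega, by omega, rfl⟩)
        have hlt : ((j + 1 : ℤ) : ℝ) / p < (k : ℝ) / p :=
          div_lt_div_of_pos_right (by exact_mod_cast (by omega : j + 1 < k)) hpR
        rcases List.mem_cons.1 hmem with h | h
        · exact hlt.ne (congrArg Prod.fst h)
        · exact hlt.not_gt (hmin _ h)
      subst hk
      have key : (j + 1) * m ≤ (i + 1) * n := by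
        rcases him.lt_or_eq with him' | rfl
        · have hmem := (he (((i + 1 : ℤ) : ℝ) / m, .v)).2
            (Or.inl ⟨i + 1, by omega, by omega, rfl⟩)
          rcases List.mem_cons.1 hmem with h | h
          · exact absurd (congrArg Prod.snd h) (by simp)
          · have := hmin _ h
            rw [div_lt_div_iff₀ hpR hmR] at this
            exact hp.mul_le hn (by omega) (by omega) this
        · nlinarith
      have := ih i (j + 1) hi (by omega) him hkn hs' fun d => by
        constructor
        · intro hd
          rcases (he d).1 (List.mem_cons_of_mem _ hd) with h | ⟨l, h₁, h₂, rfl⟩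
          · exact Or.inl h
          · refine Or.inr ⟨l, lt_of_le_of_ne (by omega) ?_, h₂, rfl⟩
            rintro rfl
            exact hnot _ hd rfl
        · intro h
          have hd : d ∈ ((((j + 1 : ℤ) : ℝ) / p, GenSymbol.h) :: e) := by
            refine (he d).2 (h.imp_right ?_)
            rintro ⟨l, h₁, h₂, rfl⟩
            exact ⟨l, by omega, h₂, rfl⟩
          rcases List.mem_cons.1 hd with rfl | hd
          · rcases h with ⟨l, h₁, h₂, h₃⟩ | ⟨l, h₁, h₂, h₃⟩
            · simp at h₃
            · have h₃ := congrArg Prod.fst h₃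
              rw [div_left_inj' hpR.ne'] at h₃
              have h₃ : j + 1 = l := by exact_mod_cast h₃
              omega
          · exact hd
      refine ⟨⟨by linarith, ?_⟩, ?_⟩
      · rw [show i * n - j * m - m = i * n - (j + 1) * m by ring]
        exact this.1
      · simp only [List.map_cons, symbolSum_cons, this.2, symbolStep]
        ext <;> simp; ring

/-- The crossings of the segment, listed by the lines that are met. -/
theorem crossing_iff {m n : ℤ} {p : ℝ} (hm : 0 < m) (hn : 0 ≤ n)
    (hp : IsSlightlyLarger m n p) (c : ℝ × GenSymbol) :
    (0 < c.1 ∧ c.1 ≤ 1 ∧ CrossesAt m p c.1 c.2) ↔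
      (∃ k : ℤ, 0 < k ∧ k ≤ m ∧ c = ((k : ℝ) / m, .v)) ∨
        ∃ k : ℤ, 0 < k ∧ k ≤ n ∧ c = ((k : ℝ) / p, .h) := by
  have hmR : (0 : ℝ) < m := by exact_mod_cast hm
  have hnR : (0 : ℝ) ≤ n := by exact_mod_cast hn
  have hpR : 0 < p := by linarith [hp.lt]
  constructor
  · obtain ⟨s, a⟩ := c
    rintro ⟨h₀, h₁, h⟩
    cases a with
    | t => exact h.elim
    | v =>
      obtain ⟨k, hk⟩ := h
      simp only at hk h₀ h₁
      refine Or.inl ⟨k, ?_, ?_, ?_⟩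
      · have : (0 : ℝ) < k := hk ▸ mul_pos h₀ hmR
        exact_mod_cast this
      · have : (k : ℝ) ≤ m := by nlinarith
        exact_mod_cast this
      · rw [← hk, mul_div_cancel_right₀ _ hmR.ne']
    | h =>
      obtain ⟨k, hk⟩ := h
      simp only at hk h₀ h₁
      refine Or.inr ⟨k, ?_, ?_, ?_⟩
      · have : (0 : ℝ) < k := hk ▸ mul_pos h₀ hpR
        exact_mod_cast this
      · have : (k : ℝ) < (n + 1 : ℤ) := by
          push_cast
          nlinarith [hp.lt_add_one]
        have : k < n + 1 := by exact_mod_cast this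
        omega
      · rw [← hk, mul_div_cancel_right₀ _ hpR.ne']
  · rintro (⟨k, hk, hkm, rfl⟩ | ⟨k, hk, hkn, rfl⟩)
    · have hkR : (0 : ℝ) < k := by exact_mod_cast hk
      exact ⟨div_pos hkR hmR, (div_le_one hmR).2 (by exact_mod_cast hkm),
        k, div_mul_cancel₀ _ hmR.ne'⟩
    · have hkR : (0 : ℝ) < k := by exact_mod_cast hk
      have hkn' : (k : ℝ) ≤ n := by exact_mod_cast hkn
      exact ⟨div_pos hkR hpR, (div_le_one hpR).2 (by linarith [hp.lt]),
        k, div_mul_cancel₀ _ hpR.ne'⟩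

theorem IsCrossingSequence.isDigitalWord {m n : ℤ} (hm : 0 < m) (hn : 0 ≤ n)
    {w : List GenSymbol} (h : IsCrossingSequence m n w) : IsDigitalWord m n w := by
  obtain ⟨p, hp, e, hs, he, rfl⟩ := h
  simpa [IsDigitalWord] using followsSlope_of_events hm hn hp e 0 0 le_rfl le_rfl hm.le hn hs
    fun c => (he c).trans (crossing_iff hm hn hp c)

theorem exists_isSlightlyLarger {m n : ℤ} (hm : 0 < m) :
    ∃ p : ℝ, IsSlightlyLarger m n p := by
  have hmR : (0 : ℝ) < m := by exact_mod_cast hm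
  have hε : 0 < 1 / ((m : ℝ) + 1) := by positivity
  have hε' : 1 / ((m : ℝ) + 1) < 1 := (div_lt_one (by linarith)).2 (by linarith)
  have hεm : (m : ℝ) * (1 / ((m : ℝ) + 1)) < 1 := by
    rw [mul_one_div, div_lt_one (by linarith)]
    linarith
  set ε := 1 / ((m : ℝ) + 1)
  -- A lattice point `(i, j)` with `i ≤ m` has `j * m - i * n` integral, but `i * ε < 1`.
  have key : ∀ i j : ℤ, (0 : ℝ) ≤ i → (i : ℝ) ≤ m → (j : ℝ) * m ≤ i * (n + ε) →
      j * m ≤ i * n := by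
    intro i j _ hi h
    have : ((j * m : ℤ) : ℝ) < (i * n + 1 : ℤ) := by
      push_cast
      nlinarith
    have : j * m < i * n + 1 := by exact_mod_cast this
    omega
  refine ⟨n + ε, by linarith, by linarith, ?_, ?_⟩
  · rintro i j ⟨a, b, ha, hb, hab, heq⟩
    simp only [Prod.smul_mk, smul_eq_mul, mul_zero, Prod.mk_add_mk, zero_add,
      Prod.mk.injEq] at heq
    have hb1 : b ≤ 1 := by linarith
    have h₁ := key i j (by rw [← heq.1]; positivity) (by rw [← heq.1]; nlinarith)
      (by rw [← heq.1, ← heq.2]; apply le_of_eq; ring)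
    have h₁ : (j : ℝ) * m ≤ i * n := by exact_mod_cast h₁
    rw [← heq.1, ← heq.2] at h₁
    have hb0 : b = 0 := by
      by_contra hne
      have : 0 < b * m * ε := by positivity
      nlinarith
    rw [hb0] at heq
    simp only [zero_mul] at heq
    exact ⟨by exact_mod_cast heq.1.symm, by exact_mod_cast heq.2.symm⟩
  · intro i j hij
    have hsub : convexHull ℝ {((0 : ℝ), (0 : ℝ)), ((m : ℝ), (n : ℝ)), ((m : ℝ), n + ε)} ⊆
        {q : ℝ × ℝ | 0 ≤ q.1 ∧ q.1 ≤ m ∧ q.2 * m ≤ q.1 * (n + ε) ∧ q.1 * n ≤ q.2 * m} := by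
      refine convexHull_min ?_ ?_
      · rintro q (rfl | rfl | rfl)
        · simp [hmR.le]
        · refine ⟨hmR.le, le_rfl, ?_, ?_⟩ <;> simp only <;> nlinarith
        · refine ⟨hmR.le, le_rfl, ?_, ?_⟩ <;> simp only <;> nlinarith
      · rintro ⟨x, y⟩ ⟨h₁, h₂, h₃, h₄⟩ ⟨x', y'⟩ ⟨h₁', h₂', h₃', h₄'⟩ a b ha hb hab
        simp only [Set.mem_ofPred_eq, Prod.smul_mk, smul_eq_mul, Prod.mk_add_mk] at *
        refine ⟨by positivity, ?_, ?_, ?_⟩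
        · obtain rfl : a = 1 - b := by linarith
          nlinarith
        · nlinarith
        · nlinarith
    obtain ⟨h₁, h₂, h₃, -⟩ := hsub (interior_subset hij)
    have h₄ : (j : ℝ) * m ≤ i * n := by exact_mod_cast key i j h₁ h₂ h₃
    -- So `(i, j)` lies on the lower side, and points just below it would be in the triangle.
    obtain ⟨δ, hδ, hball⟩ := Metric.mem_nhds_iff.1 (mem_interior_iff_mem_nhds.1 hij)
    have hmem : ((i : ℝ), (j : ℝ) - δ / 2) ∈ Metric.ball ((i : ℝ), (j : ℝ)) δ := by
      rw [Metric.mem_ball, Prod.dist_eq]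
      simp [abs_of_pos hδ, hδ]
    obtain ⟨-, -, -, h₅⟩ := hsub (hball hmem)
    simp only at h₅
    nlinarith

theorem exists_isCrossingSequence {m n : ℤ} (hm : 0 < m) (hn : 0 ≤ n) :
    ∃ w, IsCrossingSequence m n w := by
  obtain ⟨p, hp⟩ := exists_isSlightlyLarger (n := n) hm
  have hmR : (0 : ℝ) < m := by exact_mod_cast hm
  have hpR : 0 < p := by
    have hnR : (0 : ℝ) ≤ n := by exact_mod_cast hn
    linarith [hp.lt]
  have hfin : {s : ℝ | ∃ a, 0 < s ∧ s ≤ 1 ∧ CrossesAt m p s a}.Finite := by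
    refine (((Set.finite_Icc 0 m).image fun k : ℤ => (k : ℝ) / m).union
      ((Set.finite_Icc 0 n).image fun k : ℤ => (k : ℝ) / p)).subset ?_
    rintro s ⟨a, h⟩
    rcases (crossing_iff hm hn hp (s, a)).1 h with ⟨k, h₁, h₂, h₃⟩ | ⟨k, h₁, h₂, h₃⟩
    · exact Or.inl ⟨k, ⟨h₁.le, h₂⟩, (congrArg Prod.fst h₃).symm⟩
    · exact Or.inr ⟨k, ⟨h₁.le, h₂⟩, (congrArg Prod.fst h₃).symm⟩
  -- The segment meets a vertical and a horizontal line at the same time only at the origin.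
  have huniq : ∀ s a b, 0 < s → s ≤ 1 → CrossesAt m p s a → CrossesAt m p s b → a = b := by
    have hvh : ∀ s, 0 < s → s ≤ 1 → CrossesAt m p s .v → CrossesAt m p s .h → False := by
      rintro s h₀ h₁ ⟨i, hi⟩ ⟨j, hj⟩
      have := (hp.segment_lattice i j ⟨1 - s, s, by linarith, h₀.le, by ring, by
        simp [← hi, ← hj]⟩).1
      rw [this] at hi
      exact (mul_pos h₀ hmR).ne' (by simpa using hi)
    intro s a b h₀ h₁ ha hb
    cases a <;> cases b <;> first | rfl | exact ha.elim | exact hb.elim | skip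
    · exact (hvh s h₀ h₁ ha hb).elim
    · exact (hvh s h₀ h₁ hb ha).elim
  have : Nonempty GenSymbol := ⟨.t⟩
  choose! f hf using fun (s : ℝ) (hs : ∃ a, 0 < s ∧ s ≤ 1 ∧ CrossesAt m p s a) => hs
  refine ⟨_, p, hp, (hfin.toFinset.sort (· ≤ ·)).map fun s => (s, f s), ?_, ?_, rfl⟩
  · rw [List.pairwise_map]
    exact (Finset.sortedLT_sort _).pairwise
  · rintro ⟨s, a⟩
    simp only [List.mem_map, Finset.mem_sort, Set.Finite.mem_toFinset, Set.mem_ofPred_eq,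
      Prod.mk.injEq]
    constructor
    · rintro ⟨s, hs, rfl, rfl⟩
      exact hf s hs
    · intro h
      have h' := hf s ⟨a, h⟩
      exact ⟨s, ⟨a, h⟩, rfl, huniq s _ _ h.1 h.2.1 h'.2.2 h.2.2⟩

theorem isCrossingSequence_iff_isDigitalWord {m n : ℤ} (hm : 0 < m) (hn : 0 ≤ n)
    {w : List GenSymbol} : IsCrossingSequence m n w ↔ IsDigitalWord m n w := by
  refine ⟨IsCrossingSequence.isDigitalWord hm hn, fun h => ?_⟩
  obtain ⟨w', hw'⟩ := exists_isCrossingSequence hm hn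
  rwa [h.unique (hw'.isDigitalWord hm hn)]

/-! ### The ET0L system -/

instance : Finite GenSymbol :=
  Finite.of_surjective (fun i : Fin 3 => ![GenSymbol.t, .v, .h] i) fun
    | .t => ⟨0, rfl⟩
    | .v => ⟨1, rfl⟩
    | .h => ⟨2, rfl⟩

/-- The table with exactly one rule `c ↦ f c` for each letter `c`. -/
noncomputable def tableOfFun {V : Type} [Finite V] (f : V → List V) : Finset (V × List V) :=
  (Set.finite_range fun c => (c, f c)).toFinset

theorem rule_tableOfFun {V : Type} [Finite V] (f : V → List V) (c : V) (w : List V) :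
    ET0LSystem.Rule (tableOfFun f) c w ↔ w = f c := by
  simp [ET0LSystem.Rule, tableOfFun, eq_comm]

theorem tableStep_tableOfFun {V : Type} [Finite V] (f : V → List V) (u v : List V) :
    ET0LSystem.TableStep (tableOfFun f) u v ↔ v = u.flatMap f := by
  have key : ∀ ws : List (List V),
      List.Forall₂ (ET0LSystem.Rule (tableOfFun f)) u ws ↔ ws = u.map f := by
    intro ws
    simp_rw [show ET0LSystem.Rule (tableOfFun f) = fun c w => w = f c from
      funext₂ fun c w => propext (rule_tableOfFun f c w)]
    induction u generalizing ws with
    | nil => simp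
    | cons a u ih => cases ws <;> simp [ih]
  simp [ET0LSystem.TableStep, key, List.flatMap_def]

/-- The alphabet of the ET0L system: the terminal letters, nonterminal copies of the symbols, a
letter `grow` that produces a power of `v`, and letters `power b` that produce a power of `t`
(for `b = true`) or of its inverse. -/
inductive CombingSymbol
  | terminal (x : GenSymbol × Bool)
  | letter (a : GenSymbol)
  | grow
  | power (b : Bool)

instance : Finite CombingSymbol :=
  Finite.of_surjective
    (fun x : ((GenSymbol × Bool) ⊕ GenSymbol) ⊕ (Unit ⊕ Bool) => match x with
      | .inl (.inl x) => CombingSymbol.terminal x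
      | .inl (.inr a) => .letter a
      | .inr (.inl _) => .grow
      | .inr (.inr b) => .power b) fun
    | .terminal x => ⟨.inl (.inl x), rfl⟩
    | .letter a => ⟨.inl (.inr a), rfl⟩
    | .grow => ⟨.inr (.inl ()), rfl⟩
    | .power b => ⟨.inr (.inr b), rfl⟩

/-- Names for the tables of the ET0L system. -/
inductive CombingTable
  | grow
  | power
  | shear (b : Bool)
  | rotate (k : Fin 4)

instance : Finite CombingTable :=
  Finite.of_surjective
    (fun x : (Unit ⊕ Unit) ⊕ (Bool ⊕ Fin 4) => match x with
      | .inl (.inl _) => CombingTable.grow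
      | .inl (.inr _) => .power
      | .inr (.inl b) => .shear b
      | .inr (.inr k) => .rotate k) fun
    | .grow => ⟨.inl (.inl ()), rfl⟩
    | .power => ⟨.inl (.inr ()), rfl⟩
    | .shear b => ⟨.inr (.inl b), rfl⟩
    | .rotate k => ⟨.inr (.inr k), rfl⟩

/-- The tables of the ET0L system. A shear erases `grow`, so that no letter `v` is produced after
the first shear; a rotation makes all letters terminal and erases the auxiliary ones. -/
def combingRewrite : CombingTable → CombingSymbol → List CombingSymbol
  | .grow, .grow => [.letter .v, .grow]
  | .power, .power b => [.terminal (.t, b), .power b]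
  | .shear b, .letter a => (shearLetter b a).map .letter
  | .shear _, .grow => []
  | .rotate k, .letter a => [.terminal (rotateLetter^[(k : ℕ)] (a, true))]
  | .rotate _, .grow => []
  | .rotate _, .power _ => []
  | _, c => [c]

/-- An ET0L system for `semidirectLanguage`. -/
noncomputable def combingSystem : ET0LSystem (GenSymbol × Bool) where
  V := CombingSymbol
  finite_V := inferInstance
  terminal := ⟨.terminal, fun _ _ h => CombingSymbol.terminal.inj h⟩
  tables := (Set.finite_range fun T => tableOfFun (combingRewrite T)).toFinset
  axiomWords := (Set.finite_range fun b => [CombingSymbol.power b, .grow]).toFinset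

theorem combingSystem_step (u v : List CombingSymbol) :
    combingSystem.Step u v ↔ ∃ T, v = u.flatMap (combingRewrite T) := by
  constructor
  · rintro ⟨t, ht, h⟩
    obtain ⟨T, rfl⟩ := (Set.Finite.mem_toFinset _).1 ht
    exact ⟨T, (tableStep_tableOfFun (V := CombingSymbol) _ _ _).1 h⟩
  · rintro ⟨T, h⟩
    exact ⟨_, (Set.Finite.mem_toFinset _).2 ⟨T, rfl⟩,
      (tableStep_tableOfFun (V := CombingSymbol) _ _ _).2 h⟩

/-- The image of a positive word under `k` quarter turns. -/
def rotateWord (k : Fin 4) (u : List GenSymbol) : List (GenSymbol × Bool) :=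
  u.map fun a => rotateLetter^[(k : ℕ)] (a, true)

theorem flatMap_rewrite_terminal (T : CombingTable) (w : List (GenSymbol × Bool)) :
    (w.map CombingSymbol.terminal).flatMap (combingRewrite T) = w.map .terminal := by
  induction w with
  | nil => rfl
  | cons x w ih => cases T <;> simp_all [combingRewrite]

theorem flatMap_rewrite_shear (b : Bool) (u : List GenSymbol) :
    (u.map CombingSymbol.letter).flatMap (combingRewrite (.shear b)) =
      (u.flatMap (shearLetter b)).map .letter := by
  induction u with
  | nil => rfl
  | cons x w ih => simp_all [combingRewrite]

theorem flatMap_rewrite_rotate (k : Fin 4) (u : List GenSymbol) :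
    (u.map CombingSymbol.letter).flatMap (combingRewrite (.rotate k)) =
      (rotateWord k u).map .terminal := by
  induction u with
  | nil => rfl
  | cons x w ih => simp_all [combingRewrite, rotateWord]

theorem flatMap_rewrite_grow (u : List GenSymbol) :
    (u.map CombingSymbol.letter).flatMap (combingRewrite .grow) = u.map .letter := by
  induction u with
  | nil => rfl
  | cons x w ih => simp_all [combingRewrite]

theorem flatMap_rewrite_power (u : List GenSymbol) :
    (u.map CombingSymbol.letter).flatMap (combingRewrite .power) = u.map .letter := by
  induction u with
  | nil => rfl
  | cons x w ih => simp_all [combingRewrite]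

/-- The intermediate word with `i` letters `t` (or `t⁻¹`) produced so far, followed by the
nonterminal word `u`; the tail `s` is empty or the single letter `grow`. -/
def sententialForm (b : Bool) (i : ℕ) (u : List GenSymbol) (s : List CombingSymbol) :
    List CombingSymbol :=
  (List.replicate i (GenSymbol.t, b)).map .terminal ++ .power b :: (u.map .letter ++ s)

/-- A derivation has three phases: a power of `v` is being produced, shears are being applied, or
all letters are terminal. -/
theorem combingSystem_reachable {b : Bool} {u : List CombingSymbol}
    (h : Relation.ReflTransGen combingSystem.Step [CombingSymbol.power b, .grow] u) :
    (∃ i g, u = sententialForm b i (List.replicate g .v) [.grow]) ∨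
      (∃ i x, ShearGenerated x ∧ u = sententialForm b i x []) ∨
      ∃ i x k, ShearGenerated x ∧
        u = (List.replicate i (GenSymbol.t, b) ++ rotateWord k x).map .terminal := by
  induction h with
  | refl => exact Or.inl ⟨0, 0, rfl⟩
  | tail _ hstep ih =>
    obtain ⟨T, rfl⟩ := (combingSystem_step _ _).1 hstep
    rcases ih with ⟨i, g, rfl⟩ | ⟨i, x, hx, rfl⟩ | ⟨i, x, k, hx, rfl⟩
    · cases T with
      | grow =>
        refine Or.inl ⟨i, g + 1, ?_⟩
        simp only [sententialForm, List.flatMap_append, List.flatMap_cons,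
          flatMap_rewrite_terminal, flatMap_rewrite_grow, List.replicate_succ' (n := g)]
        simp [combingRewrite]
      | power =>
        refine Or.inl ⟨i + 1, g, ?_⟩
        simp only [sententialForm, List.flatMap_append, List.flatMap_cons,
          flatMap_rewrite_terminal, flatMap_rewrite_power, List.replicate_succ' (n := i)]
        simp [combingRewrite]
      | shear c =>
        refine Or.inr (Or.inl ⟨i, _, (ShearGenerated.replicate g).shear c, ?_⟩)
        simp only [sententialForm, List.flatMap_append, List.flatMap_cons,
          flatMap_rewrite_terminal, flatMap_rewrite_shear]
        simp [combingRewrite]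
      | rotate k =>
        refine Or.inr (Or.inr ⟨i, _, k, ShearGenerated.replicate g, ?_⟩)
        simp only [sententialForm, List.flatMap_append, List.flatMap_cons,
          flatMap_rewrite_terminal, flatMap_rewrite_rotate]
        simp [combingRewrite]
    · cases T with
      | grow =>
        refine Or.inr (Or.inl ⟨i, x, hx, ?_⟩)
        simp only [sententialForm, List.flatMap_append, List.flatMap_cons,
          flatMap_rewrite_terminal, flatMap_rewrite_grow]
        simp [combingRewrite]
      | power =>
        refine Or.inr (Or.inl ⟨i + 1, x, hx, ?_⟩)
        simp only [sententialForm, List.flatMap_append, List.flatMap_cons,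
          flatMap_rewrite_terminal, flatMap_rewrite_power, List.replicate_succ' (n := i)]
        simp [combingRewrite]
      | shear c =>
        refine Or.inr (Or.inl ⟨i, _, hx.shear c, ?_⟩)
        simp only [sententialForm, List.flatMap_append, List.flatMap_cons,
          flatMap_rewrite_terminal, flatMap_rewrite_shear]
        simp [combingRewrite]
      | rotate k =>
        refine Or.inr (Or.inr ⟨i, x, k, hx, ?_⟩)
        simp only [sententialForm, List.flatMap_append, List.flatMap_cons,
          flatMap_rewrite_terminal, flatMap_rewrite_rotate]
        simp [combingRewrite]
    · exact Or.inr (Or.inr ⟨i, x, k, hx, flatMap_rewrite_terminal _ _⟩)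

theorem combingSystem_derives_power (b : Bool) (i : ℕ) :
    Relation.ReflTransGen combingSystem.Step [CombingSymbol.power b, .grow]
      (sententialForm b i [] [.grow]) := by
  induction i with
  | zero => exact .refl
  | succ i ih =>
    refine ih.tail ((combingSystem_step _ _).2 ⟨.power, ?_⟩)
    simp only [sententialForm, List.flatMap_append, List.flatMap_cons,
      flatMap_rewrite_terminal, flatMap_rewrite_power, List.replicate_succ']
    simp [combingRewrite]

/-- The tail `grow` survives as long as no shear has been applied. -/
theorem combingSystem_derives_shearGenerated (b : Bool) (i : ℕ) {x : List GenSymbol}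
    (hx : ShearGenerated x) : ∃ s, (s = [] ∨ s = [CombingSymbol.grow]) ∧
      Relation.ReflTransGen combingSystem.Step [CombingSymbol.power b, .grow]
        (sententialForm b i x s) := by
  induction hx with
  | replicate g =>
    refine ⟨_, Or.inr rfl, ?_⟩
    induction g with
    | zero => exact combingSystem_derives_power b i
    | succ g ih =>
      refine ih.tail ((combingSystem_step _ _).2 ⟨.grow, ?_⟩)
      simp only [sententialForm, List.flatMap_append, List.flatMap_cons,
        flatMap_rewrite_terminal, flatMap_rewrite_grow, List.replicate_succ' (n := g)]
      simp [combingRewrite]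
  | shear c _ ih =>
    obtain ⟨s, hs, hd⟩ := ih
    refine ⟨[], Or.inl rfl, hd.tail ((combingSystem_step _ _).2 ⟨.shear c, ?_⟩)⟩
    simp only [sententialForm, List.flatMap_append, List.flatMap_cons,
      flatMap_rewrite_terminal, flatMap_rewrite_shear]
    rcases hs with rfl | rfl <;> simp [combingRewrite]

theorem mem_language_combingSystem {w : List (GenSymbol × Bool)} :
    w ∈ combingSystem.language ↔ ∃ (b : Bool) (i : ℕ) (k : Fin 4) (x : List GenSymbol),
      ShearGenerated x ∧ w = List.replicate i (.t, b) ++ rotateWord k x := by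
  have hmem : w ∈ combingSystem.language ↔ ∃ b, Relation.ReflTransGen combingSystem.Step
      [CombingSymbol.power b, .grow] (w.map CombingSymbol.terminal) := by
    constructor
    · rintro ⟨_, hi, h⟩
      obtain ⟨b, rfl⟩ := (Set.Finite.mem_toFinset _).1 hi
      exact ⟨b, h⟩
    · rintro ⟨b, h⟩
      exact ⟨_, (Set.Finite.mem_toFinset _).2 ⟨b, rfl⟩, h⟩
  have hinj : Function.Injective CombingSymbol.terminal :=
    fun _ _ h => CombingSymbol.terminal.inj h
  have hpow : ∀ b i x s, w.map CombingSymbol.terminal ≠ sententialForm b i x s := by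
    intro b i x s h
    have : CombingSymbol.power b ∈ w.map CombingSymbol.terminal := by
      rw [h]
      simp [sententialForm]
    simp at this
  rw [hmem]
  constructor
  · rintro ⟨b, h⟩
    rcases combingSystem_reachable h with ⟨i, g, h⟩ | ⟨i, x, _, h⟩ | ⟨i, x, k, hx, h⟩
    · exact absurd h (hpow _ _ _ _)
    · exact absurd h (hpow _ _ _ _)
    · exact ⟨b, i, k, x, hx, hinj.list_map h⟩
  · rintro ⟨b, i, k, x, hx, rfl⟩
    obtain ⟨s, hs, hd⟩ := combingSystem_derives_shearGenerated b i hx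
    refine ⟨b, hd.tail ((combingSystem_step _ _).2 ⟨.rotate k, ?_⟩)⟩
    simp only [sententialForm, List.flatMap_append, List.flatMap_cons,
      flatMap_rewrite_terminal, flatMap_rewrite_rotate]
    have : s.flatMap (combingRewrite (.rotate k)) = [] := by
      rcases hs with rfl | rfl <;> rfl
    rw [this, List.append_nil]
    exact List.map_append

/-! ### Membership in the languages -/

theorem mem_crossingLanguage {w : List (GenSymbol × Bool)} :
    w ∈ crossingLanguage ↔ ∃ k x, ShearGenerated x ∧ w = rotateWord k x := by
  have hrot : ∀ (k : Fin 4) (u : List GenSymbol),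
      (u.map fun a => (a, true)).map (rotateLetter^[(k : ℕ)]) = rotateWord k u := by
    simp [rotateWord]
  constructor
  · rintro (rfl | ⟨m, n, u, k, hm, hn, hu, rfl⟩)
    · exact ⟨0, _, .replicate 0, rfl⟩
    · obtain ⟨x, hx, hd⟩ := exists_shearGenerated_isDigitalWord hm hn
      rw [((isCrossingSequence_iff_isDigitalWord hm hn).1 hu).unique hd]
      exact ⟨k, x, hx, hrot k x⟩
  · rintro ⟨k, x, hx, rfl⟩
    rcases hx.eq_nil_or_isDigitalWord with rfl | ⟨m, n, hm, hn, hd⟩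
    · exact Or.inl rfl
    · exact Or.inr ⟨m, n, x, k, hm, hn, (isCrossingSequence_iff_isDigitalWord hm hn).2 hd,
        (hrot k x).symm⟩

/-- The word `t ^ e`. -/
def tPower (e : ℤ) : List (GenSymbol × Bool) :=
  List.replicate e.natAbs (.t, decide (0 ≤ e))

theorem mem_kstar_singleton {A : Type} {a : A} {w : List A} :
    w ∈ KStar.kstar ({[a]} : Language A) ↔ ∃ i, w = List.replicate i a := by
  rw [Language.mem_kstar]
  constructor
  · rintro ⟨L, rfl, hL⟩
    refine ⟨L.length, ?_⟩
    induction L with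
    | nil => rfl
    | cons x L ih =>
      have hx : x = [a] := hL x (by simp)
      rw [List.flatten_cons, ih fun y hy => hL y (List.mem_cons_of_mem _ hy), hx]
      rfl
  · rintro ⟨i, rfl⟩
    refine ⟨List.replicate i [a], by simp, fun y hy => List.eq_of_mem_replicate hy⟩

theorem mem_semidirectLanguage {w : List (GenSymbol × Bool)} :
    w ∈ semidirectLanguage ↔ ∃ b i, ∃ c ∈ crossingLanguage,
      w = List.replicate i (.t, b) ++ c := by
  simp only [semidirectLanguage, Language.mem_mul, Language.mem_add, mem_kstar_singleton]
  constructor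
  · rintro ⟨_, ⟨i, rfl⟩ | ⟨i, rfl⟩, c, hc, rfl⟩
    · exact ⟨true, i, c, hc, rfl⟩
    · exact ⟨false, i, c, hc, rfl⟩
  · rintro ⟨b, i, c, hc, rfl⟩
    cases b
    · exact ⟨_, Or.inr ⟨i, rfl⟩, c, hc, rfl⟩
    · exact ⟨_, Or.inl ⟨i, rfl⟩, c, hc, rfl⟩

theorem mem_semidirectLanguage_iff_tPower {w : List (GenSymbol × Bool)} :
    w ∈ semidirectLanguage ↔ ∃ e, ∃ c ∈ crossingLanguage, w = tPower e ++ c := by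
  rw [mem_semidirectLanguage]
  constructor
  · rintro ⟨b, i, c, hc, rfl⟩
    cases b
    · refine ⟨-i, c, hc, ?_⟩
      rcases Nat.eq_zero_or_pos i with rfl | hi
      · rfl
      · simp [tPower, hi.ne']
    · exact ⟨i, c, hc, by simp [tPower]⟩
  · rintro ⟨e, c, hc, rfl⟩
    exact ⟨_, _, c, hc, rfl⟩

theorem isET0L_semidirectLanguage : IsET0L semidirectLanguage := by
  refine ⟨combingSystem, Set.ext fun w => mem_language_combingSystem.trans ?_⟩
  refine Iff.trans ?_ mem_semidirectLanguage.symm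
  simp only [mem_crossingLanguage]
  constructor
  · rintro ⟨b, i, k, x, hx, rfl⟩
    exact ⟨b, i, _, ⟨k, x, hx, rfl⟩, rfl⟩
  · rintro ⟨b, i, _, ⟨k, x, hx, rfl⟩, rfl⟩
    exact ⟨b, i, k, x, hx, rfl⟩

/-! ### Displacements and rotations -/

/-- The displacement in `ℤ²` of a letter. -/
def letterStep (x : GenSymbol × Bool) : ℤ × ℤ :=
  if x.2 then symbolStep x.1 else -symbolStep x.1

/-- The endpoint of the lattice path of a word. -/
def wordSum (w : List (GenSymbol × Bool)) : ℤ × ℤ :=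
  (w.map letterStep).sum

/-- The rotation of `ℤ²` by a quarter turn. -/
def quarterTurn : ℤ × ℤ →+ ℤ × ℤ where
  toFun x := (-x.2, x.1)
  map_zero' := rfl
  map_add' x y := by ext <;> simp; ring

theorem quarterTurn_apply (x : ℤ × ℤ) : quarterTurn x = (-x.2, x.1) := rfl

theorem letterStep_rotateLetter (x : GenSymbol × Bool) :
    letterStep (rotateLetter x) = quarterTurn (letterStep x) := by
  obtain ⟨a, b⟩ := x
  cases a <;> cases b <;> rfl

theorem wordSum_rotateWord (k : Fin 4) (u : List GenSymbol) :
    wordSum (rotateWord k u) = quarterTurn^[(k : ℕ)] (symbolSum u) := by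
  have hl : ∀ x, letterStep (rotateLetter^[(k : ℕ)] x) = quarterTurn^[(k : ℕ)] (letterStep x) :=
    (Function.Semiconj.iterate_right letterStep_rotateLetter (k : ℕ))
  induction u with
  | nil => simp [wordSum, rotateWord, iterate_map_zero]
  | cons a u ih =>
    rw [symbolSum_cons, iterate_map_add, ← ih, show symbolStep a = letterStep (a, true) from rfl,
      ← hl]
    rfl

theorem norm_quarterTurn_iterate (k : ℕ) (x : ℤ × ℤ) : ‖quarterTurn^[k] x‖ = ‖x‖ := by
  induction k with
  | zero => rfl
  | succ k ih =>
    rw [Function.iterate_succ_apply', quarterTurn_apply, Prod.norm_def, norm_neg, max_comm]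
    exact ih

/-- The path of `w` stays close to the straight path from the origin to its endpoint: the point
reached after `k` of `l` steps is at distance at most `1` from `k / l` times the endpoint. -/
def IsStraight (w : List (GenSymbol × Bool)) : Prop :=
  ∀ k ≤ w.length, ‖(w.length : ℤ) • wordSum (w.take k) - (k : ℤ) • wordSum w‖ ≤ w.length

theorem norm_letterStep_le (x : GenSymbol × Bool) : ‖letterStep x‖ ≤ 1 := by
  obtain ⟨a, b⟩ := x
  cases a <;> cases b <;> simp [letterStep, symbolStep, Prod.norm_def]

theorem norm_wordSum_le (w : List (GenSymbol × Bool)) : ‖wordSum w‖ ≤ w.length := by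
  induction w with
  | nil => simp [wordSum]
  | cons x w ih =>
    calc ‖wordSum (x :: w)‖ = ‖letterStep x + wordSum w‖ := by simp [wordSum]
      _ ≤ ‖letterStep x‖ + ‖wordSum w‖ := norm_add_le _ _
      _ ≤ 1 + w.length := add_le_add (norm_letterStep_le x) ih
      _ = (x :: w).length := by push_cast [List.length_cons]; ring

theorem isStraight_of_mem_crossingLanguage {w : List (GenSymbol × Bool)}
    (hw : w ∈ crossingLanguage) : IsStraight w := by
  obtain ⟨r, x, hx, rfl⟩ := mem_crossingLanguage.1 hw
  rcases hx.eq_nil_or_isDigitalWord with rfl | ⟨m, n, hm, hn, hd, hs⟩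
  · intro k hk
    simp [rotateWord, wordSum]
  · intro k hk
    have hlen : (rotateWord r x).length = x.length := by simp [rotateWord]
    have htake : (rotateWord r x).take k = rotateWord r (x.take k) := by
      simp [rotateWord, List.map_take]
    have hl := hd.length_eq
    have hlk := (hd.take k).length_eq
    rw [List.length_take, min_eq_left (hlen ▸ hk)] at hlk
    have hb := hd.state_bounds hm.le hn (by omega) hm k
    rw [hs] at hl
    rw [htake, wordSum_rotateWord, wordSum_rotateWord, ← iterate_map_zsmul, ← iterate_map_zsmul,
      ← iterate_map_sub, norm_quarterTurn_iterate, hlen, hlk, hs]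
    generalize symbolSum (x.take k) = q at *
    -- With `q = (i, j)` and `k = i + j`, both coordinates are `i * n - j * m` up to sign.
    rw [hl]
    have hl' : (x.length : ℝ) = ((m + n : ℤ) : ℝ) := by rw [← hl]; rfl
    rw [hl', Prod.norm_def, max_le_iff, Int.norm_eq_abs, Int.norm_eq_abs]
    simp only [zero_add, Prod.fst_sub, Prod.snd_sub, Prod.smul_fst, Prod.smul_snd,
      smul_eq_mul] at hb ⊢
    constructor <;> rw [abs_le] <;> constructor <;> norm_cast <;> nlinarith

/-! ### Reparametrizations and fellow travelling -/

theorem isReparametrization_mul_div {a N : ℕ} (ha : 0 < a) (haN : a ≤ N) :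
    IsReparametrization fun i => i * a / N := by
  have hN : 0 < N := ha.trans_le haN
  refine ⟨by simp, fun i => ?_, fun M => ⟨N * M, ?_⟩⟩
  · have h₁ : i * a / N ≤ (i + 1) * a / N := Nat.div_le_div_right (by nlinarith)
    have h₂ : (i + 1) * a / N ≤ i * a / N + 1 := by
      rw [← Nat.add_div_right _ hN]
      exact Nat.div_le_div_right (by nlinarith)
    simp only
    omega
  · simp only
    rw [mul_assoc, Nat.mul_div_cancel_left _ hN]
    nlinarith

theorem IsReparametrization.delay {ρ : ℕ → ℕ} (h : IsReparametrization ρ) :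
    IsReparametrization fun i => ρ (i - 1) := by
  refine ⟨h.1, fun i => ?_, fun N => ?_⟩
  · cases i with
    | zero => simp
    | succ i => exact h.2.1 i
  · obtain ⟨i, hi⟩ := h.2.2 N
    exact ⟨i + 1, hi⟩

/-- First advance by one step, then follow `ρ`. -/
def advance (ρ : ℕ → ℕ) : ℕ → ℕ
  | 0 => 0
  | i + 1 => ρ i + 1

theorem IsReparametrization.advance {ρ : ℕ → ℕ} (h : IsReparametrization ρ) :
    IsReparametrization (advance ρ) := by
  refine ⟨rfl, fun i => ?_, fun N => ?_⟩
  · cases i with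
    | zero => exact Or.inr (by simp [_root_.advance, h.1])
    | succ i => exact (h.2.1 i).imp (congrArg (· + 1)) (congrArg (· + 1))
  · obtain ⟨i, hi⟩ := h.2.2 N
    exact ⟨i + 1, hi.trans (Nat.le_succ _)⟩

section Combing

variable {G : Type} [Group G] {ι : Type} {gen : ι → G}

theorem wordValue_append (u w : List (ι × Bool)) :
    wordValue gen (u ++ w) = wordValue gen u * wordValue gen w := by
  simp [wordValue]

theorem wordValue_cons (x : ι × Bool) (w : List (ι × Bool)) :
    wordValue gen (x :: w) = letterValue gen x * wordValue gen w := by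
  simp [wordValue]

theorem letterValue_not (a : ι) (b : Bool) :
    letterValue gen (a, !b) = (letterValue gen (a, b))⁻¹ := by
  cases b <;> simp [letterValue]

theorem exists_wordValue_inv (u : List (ι × Bool)) :
    ∃ u' : List (ι × Bool), u'.length = u.length ∧ wordValue gen u' = (wordValue gen u)⁻¹ := by
  induction u with
  | nil => exact ⟨[], rfl, by simp [wordValue]⟩
  | cons x u ih =>
    obtain ⟨u', hl, hv⟩ := ih
    refine ⟨u' ++ [(x.1, !x.2)], by simp [hl], ?_⟩
    rw [wordValue_append, hv, wordValue_cons, wordValue_cons, letterValue_not]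
    simp [wordValue]

theorem CayleyDistLE.refl (k : ℕ) (g : G) : CayleyDistLE gen k g g :=
  ⟨[], by simp, by simp [wordValue]⟩

theorem CayleyDistLE.symm {k : ℕ} {g g' : G} (h : CayleyDistLE gen k g g') :
    CayleyDistLE gen k g' g := by
  obtain ⟨u, hu, rfl⟩ := h
  obtain ⟨u', hl, hv⟩ := exists_wordValue_inv (gen := gen) u
  exact ⟨u', hl.trans_le hu, by simp [hv]⟩

theorem CayleyDistLE.mono {k k' : ℕ} (hk : k ≤ k') {g g' : G} (h : CayleyDistLE gen k g g') :
    CayleyDistLE gen k' g g' :=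
  let ⟨u, hu, e⟩ := h
  ⟨u, hu.trans hk, e⟩

theorem CayleyDistLE.mul_left {k : ℕ} {g g' : G} (h : CayleyDistLE gen k g g') (x : G) :
    CayleyDistLE gen k (x * g) (x * g') := by
  obtain ⟨u, hu, rfl⟩ := h
  exact ⟨u, hu, mul_assoc _ _ _⟩

theorem CayleyDistLE.trans {k k' : ℕ} {g g' g'' : G} (h : CayleyDistLE gen k g g')
    (h' : CayleyDistLE gen k' g' g'') : CayleyDistLE gen (k + k') g g'' := by
  obtain ⟨u, hu, rfl⟩ := h
  obtain ⟨u', hu', rfl⟩ := h'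
  exact ⟨u ++ u', by simp; omega, by rw [wordValue_append, mul_assoc]⟩

theorem cayleyDistLE_letter (g : G) (x : ι × Bool) :
    CayleyDistLE gen 1 g (g * letterValue gen x) :=
  ⟨[x], le_rfl, by simp [wordValue]⟩

theorem cayleyDistLE_one_iff {g g' : G} :
    CayleyDistLE gen 1 g g' ↔ g = g' ∨ ∃ x, g * letterValue gen x = g' := by
  constructor
  · rintro ⟨u, hu, rfl⟩
    match u, hu with
    | [], _ => exact Or.inl (by simp [wordValue])
    | [x], _ => exact Or.inr ⟨x, by simp [wordValue]⟩
  · rintro (rfl | ⟨x, rfl⟩)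
    · exact .refl _ _
    · exact cayleyDistLE_letter g x

theorem AsyncFellowTravel.symm {K : ℕ} {w w' : List (ι × Bool)}
    (h : AsyncFellowTravel gen K w w') : AsyncFellowTravel gen K w' w :=
  let ⟨ρ, ρ', hρ, hρ', h⟩ := h
  ⟨ρ', ρ, hρ', hρ, fun n => (h n).symm⟩

theorem AsyncFellowTravel.mono {K K' : ℕ} (hK : K ≤ K') {w w' : List (ι × Bool)}
    (h : AsyncFellowTravel gen K w w') : AsyncFellowTravel gen K' w w' :=
  let ⟨ρ, ρ', hρ, hρ', h⟩ := h
  ⟨ρ, ρ', hρ, hρ', fun n => (h n).mono hK⟩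

theorem AsyncFellowTravel.cons {K : ℕ} {w w' : List (ι × Bool)}
    (h : AsyncFellowTravel gen K w w') (x : ι × Bool) :
    AsyncFellowTravel gen K (x :: w) (x :: w') := by
  obtain ⟨ρ, ρ', hρ, hρ', h⟩ := h
  refine ⟨_, _, hρ.advance, hρ'.advance, fun n => ?_⟩
  cases n with
  | zero => exact .refl _ _
  | succ n =>
    simp only [pathVertex, advance, List.take_succ_cons, wordValue_cons]
    exact (h n).mul_left _

theorem AsyncFellowTravel.append {K : ℕ} {w w' : List (ι × Bool)}
    (h : AsyncFellowTravel gen K w w') (u : List (ι × Bool)) :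
    AsyncFellowTravel gen K (u ++ w) (u ++ w') := by
  induction u with
  | nil => exact h
  | cons x u ih => exact ih.cons x

/-- If `w` fellow-travels the translate of `w'` by the letter `x`, then it fellow-travels
`x :: w'`: the path of `w` waits at the origin while the other one runs through `x`. -/
theorem asyncFellowTravel_cons_right {K : ℕ} {w w' : List (ι × Bool)} {x : ι × Bool}
    {ρ ρ' : ℕ → ℕ} (hρ : IsReparametrization ρ) (hρ' : IsReparametrization ρ')
    (h : ∀ n, CayleyDistLE gen K (pathVertex gen w (ρ n))
      (letterValue gen x * pathVertex gen w' (ρ' n))) :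
    AsyncFellowTravel gen K w (x :: w') := by
  refine ⟨_, _, hρ.delay, hρ'.advance, fun n => ?_⟩
  cases n with
  | zero =>
    simp only [pathVertex, advance, hρ.1, List.take_zero]
    exact .refl _ _
  | succ n =>
    simp only [pathVertex, advance, List.take_succ_cons, wordValue_cons]
    exact h n

end Combing

/-- Straight paths that end close to each other, after a linear map is applied to the first one,
stay close to each other when both are traversed at constant speed. -/
theorem exists_reparametrization_of_isStraight (A : ℤ × ℤ →+ ℤ × ℤ) :
    ∃ K : ℕ, ∀ w w' : List (GenSymbol × Bool), IsStraight w → IsStraight w' →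
      ‖A (wordSum w) - wordSum w'‖ ≤ 1 →
      ∃ ρ ρ' : ℕ → ℕ, IsReparametrization ρ ∧ IsReparametrization ρ' ∧
        ∀ n, ‖A (wordSum (w.take (ρ n))) - wordSum (w'.take (ρ' n))‖ ≤ K := by
  obtain ⟨M, hM⟩ : ∃ M : ℕ, ∀ x, ‖A x‖ ≤ M * ‖x‖ := by
    obtain ⟨M, hM⟩ := exists_nat_ge (‖A (1, 0)‖ + ‖A (0, 1)‖)
    refine ⟨M, fun x => ?_⟩
    have hx : x = x.1 • ((1, 0) : ℤ × ℤ) + x.2 • ((0, 1) : ℤ × ℤ) := by ext <;> simp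
    calc ‖A x‖ = ‖x.1 • A (1, 0) + x.2 • A (0, 1)‖ := by
          conv_lhs => rw [hx]
          rw [map_add, map_zsmul, map_zsmul]
      _ ≤ ‖x.1‖ * ‖A (1, 0)‖ + ‖x.2‖ * ‖A (0, 1)‖ :=
          (norm_add_le _ _).trans (add_le_add (norm_smul_le _ _) (norm_smul_le _ _))
      _ ≤ ‖x‖ * ‖A (1, 0)‖ + ‖x‖ * ‖A (0, 1)‖ := by
          gcongr
          · exact norm_fst_le x
          · exact norm_snd_le x
      _ = (‖A (1, 0)‖ + ‖A (0, 1)‖) * ‖x‖ := by ring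
      _ ≤ M * ‖x‖ := by gcongr
  -- At time `i ≤ N`, a straight path traversed in time `N` is within `2` of `i / N` times its end.
  have key : ∀ (w : List (GenSymbol × Bool)) (N i : ℕ), IsStraight w → w.length + 1 ≤ N → i < N →
      ‖(N : ℤ) • wordSum (w.take (i * (w.length + 1) / N)) - (i : ℤ) • wordSum w‖ ≤ 2 * N := by
    intro w N i hw hN hi
    rcases Nat.eq_zero_or_pos w.length with hl | hl
    · obtain rfl := List.length_eq_zero_iff.1 hl
      simp [wordSum]
    · have hN0 : 0 < N := by omega
      set k := i * (w.length + 1) / N with hk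
      have hkN : k * N ≤ i * (w.length + 1) := Nat.div_mul_le_self _ _
      have hkN' : i * (w.length + 1) < (k + 1) * N := by
        rw [mul_comm (k + 1)]
        exact Nat.lt_mul_div_succ _ hN0
      have hkl : k ≤ w.length := by
        have : k < w.length + 1 := (Nat.div_lt_iff_lt_mul hN0).2 (by nlinarith)
        omega
      have hlR : (0 : ℝ) < w.length := by exact_mod_cast hl
      have h₁ := hw k hkl
      have h₂ : ‖((N * k - i * w.length : ℤ))‖ ≤ (N : ℝ) := by
        zify at hkN hkN' hi
        have ha : |(N * k - i * w.length : ℤ)| ≤ N := by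
          rw [abs_le]
          constructor <;> nlinarith
        rw [Int.norm_eq_abs]
        exact_mod_cast ha
      have h₃ : (w.length : ℤ) • ((N : ℤ) • wordSum (w.take k) - (i : ℤ) • wordSum w) =
          (N : ℤ) • ((w.length : ℤ) • wordSum (w.take k) - (k : ℤ) • wordSum w) +
            (N * k - i * w.length : ℤ) • wordSum w := by
        module
      have h₄ := congrArg norm h₃
      rw [norm_smul, Int.norm_natCast] at h₄
      have h₅ : (w.length : ℝ) * ‖(N : ℤ) • wordSum (w.take k) - (i : ℤ) • wordSum w‖ ≤
          N * w.length + N * w.length := by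
        rw [h₄]
        refine (norm_add_le _ _).trans (add_le_add ?_ ?_)
        · rw [norm_smul, Int.norm_natCast]
          gcongr
        · rw [norm_smul]
          gcongr
          exact norm_wordSum_le w
      nlinarith
  refine ⟨2 * M + 3, fun w w' hw hw' h => ?_⟩
  set N := w.length + w'.length + 2 with hN
  refine ⟨_, _, isReparametrization_mul_div (a := w.length + 1) (N := N) (by omega) (by omega),
    isReparametrization_mul_div (a := w'.length + 1) (N := N) (by omega) (by omega), fun i => ?_⟩
  have hN0 : 0 < N := by omega
  rcases lt_or_ge i N with hi | hi
  · have h₁ := key w N i hw (by omega) hi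
    have h₂ := key w' N i hw' (by omega) hi
    generalize wordSum (w.take _) = x at *
    generalize wordSum (w'.take _) = x' at *
    have h₃ : (N : ℤ) • (A x - x') = A ((N : ℤ) • x - (i : ℤ) • wordSum w) +
        (i : ℤ) • (A (wordSum w) - wordSum w') - ((N : ℤ) • x' - (i : ℤ) • wordSum w') := by
      rw [map_sub, map_zsmul, map_zsmul]
      module
    have h₄ := congrArg norm h₃
    rw [norm_smul, Int.norm_natCast] at h₄
    have hNR : (0 : ℝ) < N := by exact_mod_cast hN0
    have hiR : (i : ℝ) ≤ N := by exact_mod_cast hi.le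
    have h₅ : (N : ℝ) * ‖A x - x'‖ ≤ M * (2 * N) + N * 1 + 2 * N := by
      rw [h₄]
      refine (norm_sub_le _ _).trans (add_le_add ((norm_add_le _ _).trans (add_le_add ?_ ?_)) h₂)
      · exact (hM _).trans (by gcongr)
      · rw [norm_smul, Int.norm_natCast]
        gcongr
    push_cast
    nlinarith
  · have hend : ∀ l, l + 1 ≤ N → l ≤ i * (l + 1) / N := by
      intro l hl
      rw [Nat.le_div_iff_mul_le hN0]
      nlinarith
    rw [List.take_of_length_le (hend _ (by omega)), List.take_of_length_le (hend _ (by omega))]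
    refine h.trans ?_
    push_cast
    linarith [(Nat.cast_nonneg M : (0 : ℝ) ≤ M)]

/-! ### The normal forms of `ℤ²` -/

theorem ShearGenerated.fst_pos_snd_nonneg {x : List GenSymbol} (hx : ShearGenerated x)
    (h : x ≠ []) : 0 < (symbolSum x).1 ∧ 0 ≤ (symbolSum x).2 := by
  obtain ⟨m, n, hm, hn, hd⟩ := hx.eq_nil_or_isDigitalWord.resolve_left h
  rw [hd.2]
  exact ⟨hm, hn⟩

theorem ShearGenerated.eq_of_symbolSum_eq {x x' : List GenSymbol} (hx : ShearGenerated x)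
    (hx' : ShearGenerated x') (h : x ≠ []) (h' : x' ≠ []) (hs : symbolSum x = symbolSum x') :
    x = x' := by
  obtain ⟨m, n, hm, hn, hd⟩ := hx.eq_nil_or_isDigitalWord.resolve_left h
  obtain ⟨m', n', hm', hn', hd'⟩ := hx'.eq_nil_or_isDigitalWord.resolve_left h'
  rw [hd.2, hd'.2, Prod.mk.injEq] at hs
  obtain ⟨rfl, rfl⟩ := hs
  exact hd.unique hd'

/-- The four rotated images of the quadrant `m > 0`, `n ≥ 0` are disjoint. -/
theorem quarterTurn_iterate_inj {k k' : Fin 4} {a a' : ℤ × ℤ} (ha : 0 < a.1 ∧ 0 ≤ a.2)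
    (ha' : 0 < a'.1 ∧ 0 ≤ a'.2)
    (h : quarterTurn^[(k : ℕ)] a = quarterTurn^[(k' : ℕ)] a') : k = k' ∧ a = a' := by
  obtain ⟨m, n⟩ := a
  obtain ⟨m', n'⟩ := a'
  fin_cases k <;> fin_cases k' <;>
    simp [quarterTurn_apply, Function.iterate_succ_apply'] at h ha ha' ⊢ <;> omega

/-- The four rotated images of the quadrant `m > 0`, `n ≥ 0` cover `ℤ²` without the origin. -/
theorem exists_quarterTurn_iterate (a : ℤ × ℤ) (h : a ≠ 0) :
    ∃ (k : Fin 4) (m n : ℤ), 0 < m ∧ 0 ≤ n ∧ quarterTurn^[(k : ℕ)] (m, n) = a := by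
  obtain ⟨x, y⟩ := a
  have h : ¬ (x = 0 ∧ y = 0) := fun hxy => h (Prod.ext hxy.1 hxy.2)
  rcases lt_or_ge 0 x with hx | hx
  · rcases le_or_gt 0 y with hy | hy
    · exact ⟨0, x, y, hx, hy, rfl⟩
    · exact ⟨3, -y, x, by omega, hx.le, by
        simp [quarterTurn_apply, Function.iterate_succ_apply']⟩
  · rcases lt_or_ge 0 y with hy | hy
    · exact ⟨1, y, -x, hy, by omega, by simp [quarterTurn_apply]⟩
    · rcases hx.lt_or_eq with hx | rfl
      · exact ⟨2, -x, -y, by omega, by omega, by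
          simp [quarterTurn_apply, Function.iterate_succ_apply']⟩
      · exact ⟨3, -y, 0, by omega, le_rfl, by
          simp [quarterTurn_apply, Function.iterate_succ_apply']⟩

theorem wordSum_injOn_crossingLanguage {c c' : List (GenSymbol × Bool)}
    (hc : c ∈ crossingLanguage) (hc' : c' ∈ crossingLanguage) (h : wordSum c = wordSum c') :
    c = c' := by
  obtain ⟨k, x, hx, rfl⟩ := mem_crossingLanguage.1 hc
  obtain ⟨k', x', hx', rfl⟩ := mem_crossingLanguage.1 hc'
  rw [wordSum_rotateWord, wordSum_rotateWord] at h
  have hzero : ∀ (k : Fin 4) (a : ℤ × ℤ), quarterTurn^[(k : ℕ)] a = 0 → a = 0 := fun k a h => by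
    rw [← norm_eq_zero, ← norm_quarterTurn_iterate k a, h, norm_zero]
  by_cases hn : x = [] <;> by_cases hn' : x' = []
  · rw [hn, hn']
    rfl
  · rw [hn, symbolSum_nil, iterate_map_zero] at h
    have h₁ := (hx'.fst_pos_snd_nonneg hn').1
    rw [hzero k' _ h.symm] at h₁
    exact absurd h₁ (lt_irrefl _)
  · rw [hn', symbolSum_nil, iterate_map_zero] at h
    have h₁ := (hx.fst_pos_snd_nonneg hn).1
    rw [hzero k _ h] at h₁
    exact absurd h₁ (lt_irrefl _)
  · obtain ⟨rfl, hs⟩ :=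
      quarterTurn_iterate_inj (hx.fst_pos_snd_nonneg hn) (hx'.fst_pos_snd_nonneg hn') h
    rw [hx.eq_of_symbolSum_eq hx' hn hn' hs]

theorem exists_mem_crossingLanguage (a : ℤ × ℤ) : ∃ c ∈ crossingLanguage, wordSum c = a := by
  by_cases h : a = 0
  · exact ⟨[], Or.inl rfl, by simp [wordSum, h]⟩
  · obtain ⟨k, m, n, hm, hn, rfl⟩ := exists_quarterTurn_iterate a h
    obtain ⟨x, hx, hd⟩ := exists_shearGenerated_isDigitalWord hm hn
    exact ⟨_, mem_crossingLanguage.2 ⟨k, x, hx, rfl⟩, by rw [wordSum_rotateWord, hd.2]⟩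

theorem fst_ne_t_of_mem_crossingLanguage {c : List (GenSymbol × Bool)}
    (hc : c ∈ crossingLanguage) : ∀ x ∈ c, x.1 ≠ .t := by
  have hrot : ∀ (k : ℕ) (x : GenSymbol × Bool), x.1 ≠ .t → (rotateLetter^[k] x).1 ≠ .t := by
    intro k x hx
    induction k with
    | zero => exact hx
    | succ k ih =>
      rw [Function.iterate_succ_apply']
      generalize rotateLetter^[k] x = y at *
      obtain ⟨a, b⟩ := y
      cases a <;> simp_all [rotateLetter]
  obtain ⟨k, x, hx, rfl⟩ := mem_crossingLanguage.1 hc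
  have ht : GenSymbol.t ∉ x := by
    rcases hx.eq_nil_or_isDigitalWord with rfl | ⟨m, n, -, -, hd⟩
    · simp
    · exact hd.1.not_mem_t
  intro y hy
  obtain ⟨a, ha, rfl⟩ := List.mem_map.1 hy
  exact hrot k _ fun h => ht (h ▸ ha)

/-! ### The semidirect product -/

section Semidirect

variable (φ : Multiplicative ℤ →* MulAut (Multiplicative (ℤ × ℤ))) (τ : Multiplicative ℤ)

/-- The element of the semidirect product given by a vector of `ℤ²`. -/
def latticeElement (a : ℤ × ℤ) : Multiplicative (ℤ × ℤ) ⋊[φ] Multiplicative ℤ :=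
  SemidirectProduct.inl (Multiplicative.ofAdd a)

theorem latticeElement_add (a b : ℤ × ℤ) :
    latticeElement φ (a + b) = latticeElement φ a * latticeElement φ b := by
  simp [latticeElement]

theorem latticeElement_neg (a : ℤ × ℤ) :
    latticeElement φ (-a) = (latticeElement φ a)⁻¹ := by
  simp [latticeElement]

variable {φ τ}

theorem letterValue_eq_latticeElement {x : GenSymbol × Bool} (hx : x.1 ≠ .t) :
    letterValue (semidirectGen φ τ) x = latticeElement φ (letterStep x) := by
  obtain ⟨a, b⟩ := x
  cases a
  · exact absurd rfl hx
  all_goals cases b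
  all_goals simp only [letterValue, letterStep, Bool.false_eq_true, if_false, if_true,
    latticeElement_neg]
  all_goals rfl

theorem wordValue_eq_latticeElement {w : List (GenSymbol × Bool)} (hw : ∀ x ∈ w, x.1 ≠ .t) :
    wordValue (semidirectGen φ τ) w = latticeElement φ (wordSum w) := by
  induction w with
  | nil => simp [wordValue, wordSum, latticeElement]
  | cons x w ih =>
    rw [wordValue_cons, ih fun y hy => hw y (List.mem_cons_of_mem _ hy),
      letterValue_eq_latticeElement (hw x (by simp)), ← latticeElement_add]
    simp [wordSum]

theorem wordValue_tPower (e : ℤ) :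
    wordValue (semidirectGen φ τ) (tPower e) = SemidirectProduct.inr (τ ^ e) := by
  have h : wordValue (semidirectGen φ τ) (tPower e) =
      letterValue (semidirectGen φ τ) (.t, decide (0 ≤ e)) ^ e.natAbs := by
    simp [wordValue, tPower]
  rw [h]
  rcases le_or_gt 0 e with he | he
  · lift e to ℕ using he
    simp [letterValue, semidirectGen]
  · obtain ⟨k, rfl⟩ : ∃ k : ℕ, e = -k := ⟨e.natAbs, by omega⟩
    have hk : k ≠ 0 := by omega
    simp [letterValue, semidirectGen, hk]

theorem cayleyDistLE_latticeElement {K : ℕ} {a b : ℤ × ℤ} (h : ‖a - b‖ ≤ K) :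
    CayleyDistLE (semidirectGen φ τ) (2 * K) (latticeElement φ a) (latticeElement φ b) := by
  have h₁ : |(a - b).1| ≤ K := by
    have := (norm_fst_le (a - b)).trans h
    rw [Int.norm_eq_abs] at this
    exact_mod_cast this
  have h₂ : |(a - b).2| ≤ K := by
    have := (norm_snd_le (a - b)).trans h
    rw [Int.norm_eq_abs] at this
    exact_mod_cast this
  generalize hu : b - a = z
  obtain ⟨x, y⟩ := z
  obtain rfl : b = a + (x, y) := by rw [← hu]; abel
  simp only [sub_add_cancel_left, Prod.fst_neg, Prod.snd_neg, abs_neg, Int.abs_eq_natAbs]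
    at h₁ h₂
  refine ⟨List.replicate x.natAbs (.v, decide (0 ≤ x)) ++
    List.replicate y.natAbs (.h, decide (0 ≤ y)), ?_, ?_⟩
  · rw [List.length_append, List.length_replicate, List.length_replicate]
    omega
  · rw [wordValue_eq_latticeElement, ← latticeElement_add]
    · congr 2
      rcases le_or_gt 0 x with hx | hx <;> rcases le_or_gt 0 y with hy | hy <;>
        ext <;> simp [wordSum, letterStep, symbolStep, hx, hy, not_le.2, abs_of_nonneg, abs_of_neg]
    · intro z hz
      rcases List.mem_append.1 hz with hz | hz <;> rw [List.eq_of_mem_replicate hz] <;> simp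

/-- The action of an element of the factor `ℤ` on `ℤ²`, as an additive map. -/
def actionHom (φ : Multiplicative ℤ →* MulAut (Multiplicative (ℤ × ℤ))) (q : Multiplicative ℤ) :
    ℤ × ℤ →+ ℤ × ℤ where
  toFun a := (φ q (Multiplicative.ofAdd a)).toAdd
  map_zero' := by simp
  map_add' a b := by simp

theorem latticeElement_injective : Function.Injective (latticeElement φ) :=
  SemidirectProduct.inl_injective.comp Multiplicative.ofAdd.injective

theorem latticeElement_mul_inr (a : ℤ × ℤ) (q : Multiplicative ℤ) :
    latticeElement φ a * SemidirectProduct.inr q =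
      SemidirectProduct.inr q * latticeElement φ (actionHom φ q⁻¹ a) := by
  have h : latticeElement φ (actionHom φ q⁻¹ a) =
      SemidirectProduct.inr q⁻¹ * latticeElement φ a * SemidirectProduct.inr q⁻¹⁻¹ :=
    (SemidirectProduct.inl_aut _ _).trans (by simp [latticeElement])
  rw [h]
  simp [mul_assoc]

theorem letterValue_t (b : Bool) : letterValue (semidirectGen φ τ) (.t, b) =
    SemidirectProduct.inr (if b then τ else τ⁻¹) := by
  cases b <;> simp [letterValue, semidirectGen]

theorem wordValue_tPower_append (e : ℤ) {c : List (GenSymbol × Bool)}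
    (hc : c ∈ crossingLanguage) : wordValue (semidirectGen φ τ) (tPower e ++ c) =
      SemidirectProduct.inr (τ ^ e) * latticeElement φ (wordSum c) := by
  rw [wordValue_append, wordValue_tPower,
    wordValue_eq_latticeElement (fst_ne_t_of_mem_crossingLanguage hc)]

theorem pathVertex_of_mem_crossingLanguage {c : List (GenSymbol × Bool)}
    (hc : c ∈ crossingLanguage) (n : ℕ) :
    pathVertex (semidirectGen φ τ) c n = latticeElement φ (wordSum (c.take n)) :=
  wordValue_eq_latticeElement fun x hx =>
    fst_ne_t_of_mem_crossingLanguage hc x (List.mem_of_mem_take hx)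

/-- Two words of the crossing language with neighbouring endpoints fellow-travel. -/
theorem exists_asyncFellowTravel_crossingLanguage : ∃ K : ℕ, ∀ c ∈ crossingLanguage,
    ∀ c' ∈ crossingLanguage, ‖wordSum c - wordSum c'‖ ≤ 1 →
      AsyncFellowTravel (semidirectGen φ τ) K c c' := by
  obtain ⟨K, hK⟩ := exists_reparametrization_of_isStraight (AddMonoidHom.id _)
  refine ⟨2 * K, fun c hc c' hc' h => ?_⟩
  obtain ⟨ρ, ρ', hρ, hρ', h⟩ := hK c c' (isStraight_of_mem_crossingLanguage hc)
    (isStraight_of_mem_crossingLanguage hc') h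
  refine ⟨ρ, ρ', hρ, hρ', fun n => ?_⟩
  rw [pathVertex_of_mem_crossingLanguage hc, pathVertex_of_mem_crossingLanguage hc']
  exact cayleyDistLE_latticeElement (h n)

/-- If `c t = t c'` (or `c t⁻¹ = t⁻¹ c'`) in the semidirect product, then `c` and `t c'`
fellow-travel: conjugation by `t` is linear, so it carries the nearly straight path of `c` to a
path close to that of `c'`. -/
theorem exists_asyncFellowTravel_cons_t (b : Bool) : ∃ K : ℕ, ∀ c ∈ crossingLanguage,
    ∀ c' ∈ crossingLanguage,
      latticeElement φ (wordSum c) * letterValue (semidirectGen φ τ) (.t, b) =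
        letterValue (semidirectGen φ τ) (.t, b) * latticeElement φ (wordSum c') →
      AsyncFellowTravel (semidirectGen φ τ) K c ((.t, b) :: c') := by
  set q := if b then τ else τ⁻¹ with hq
  have ht : letterValue (semidirectGen φ τ) (.t, b) = SemidirectProduct.inr q := letterValue_t b
  obtain ⟨K, hK⟩ := exists_reparametrization_of_isStraight (actionHom φ q⁻¹)
  refine ⟨1 + 2 * K, fun c hc c' hc' h => ?_⟩
  rw [ht, latticeElement_mul_inr, mul_right_inj] at h
  obtain ⟨ρ, ρ', hρ, hρ', hd⟩ := hK c c' (isStraight_of_mem_crossingLanguage hc)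
    (isStraight_of_mem_crossingLanguage hc') (by simp [latticeElement_injective h])
  refine asyncFellowTravel_cons_right hρ hρ' fun n => ?_
  rw [pathVertex_of_mem_crossingLanguage hc, pathVertex_of_mem_crossingLanguage hc']
  refine (cayleyDistLE_letter _ (.t, b)).trans ?_
  rw [ht, latticeElement_mul_inr]
  exact (cayleyDistLE_latticeElement (hd n)).mul_left _

theorem zpow_injective_of_zpowers_eq_top (hτ : Subgroup.zpowers τ = ⊤) :
    Function.Injective fun e : ℤ => τ ^ e := by
  have h1 : τ ≠ 1 := by
    rintro rfl
    rw [Subgroup.zpowers_one_eq_bot] at hτ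
    exact bot_ne_top hτ
  intro e e' h
  have h := congrArg Multiplicative.toAdd h
  simp only [toAdd_zpow, smul_eq_mul] at h
  exact mul_right_cancel₀ (fun h0 => h1 (Multiplicative.toAdd.injective h0)) h

theorem tPower_add_one_of_nonneg {e : ℤ} (he : 0 ≤ e) :
    tPower (e + 1) = tPower e ++ [(.t, true)] := by
  lift e to ℕ using he
  have h : ((e : ℤ) + 1).natAbs = e + 1 := by omega
  have h' : (0 : ℤ) ≤ e + 1 := by omega
  simp [tPower, h, h', List.replicate_succ']

theorem tPower_of_neg {e : ℤ} (he : e < 0) :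
    tPower e = tPower (e + 1) ++ [(.t, false)] := by
  have h : e.natAbs = (e + 1).natAbs + 1 := by omega
  rcases eq_or_ne e (-1) with rfl | h'
  · rfl
  · have h₁ : ¬ 0 ≤ e + 1 := by omega
    simp [tPower, h, h₁, not_le.2 he, List.replicate_succ']

/-- The relation in the semidirect product that holds between neighbours `g` and `g t`. -/
theorem latticeElement_mul_t {e : ℤ} {a a' : ℤ × ℤ}
    (h : (SemidirectProduct.inr (τ ^ e) * latticeElement φ a) * SemidirectProduct.inr τ =
      SemidirectProduct.inr (τ ^ (e + 1)) * latticeElement φ a') :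
    latticeElement φ a * SemidirectProduct.inr τ =
      SemidirectProduct.inr τ * latticeElement φ a' := by
  rw [zpow_add_one, map_mul, mul_assoc, mul_assoc, mul_right_inj] at h
  exact h

theorem zpow_exponent_eq (hτ : Subgroup.zpowers τ = ⊤) {e e' : ℤ} {a a' : ℤ × ℤ}
    (h : SemidirectProduct.inr (τ ^ e) * latticeElement φ a =
      SemidirectProduct.inr (τ ^ e') * latticeElement φ a') : e = e' :=
  zpow_injective_of_zpowers_eq_top hτ (by
    simpa [latticeElement, -map_zpow] using congrArg SemidirectProduct.rightHom h)

theorem bijOn_wordValue_semidirectLanguage (hτ : Subgroup.zpowers τ = ⊤) :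
    Set.BijOn (wordValue (semidirectGen φ τ)) {w | w ∈ semidirectLanguage} Set.univ := by
  refine ⟨fun _ _ => trivial, ?_, ?_⟩
  · intro w hw w' hw' h
    obtain ⟨e, c, hc, rfl⟩ := mem_semidirectLanguage_iff_tPower.1 hw
    obtain ⟨e', c', hc', rfl⟩ := mem_semidirectLanguage_iff_tPower.1 hw'
    rw [wordValue_tPower_append e hc, wordValue_tPower_append e' hc'] at h
    obtain rfl := zpow_exponent_eq hτ h
    rw [wordSum_injOn_crossingLanguage hc hc' (latticeElement_injective (mul_left_cancel h))]
  · intro g _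
    obtain ⟨e, he⟩ := Subgroup.mem_zpowers_iff.1 (hτ ▸ Subgroup.mem_top g.right)
    obtain ⟨c, hc, hs⟩ := exists_mem_crossingLanguage (actionHom φ g.right⁻¹ g.left.toAdd)
    refine ⟨_, mem_semidirectLanguage_iff_tPower.2 ⟨e, c, hc, rfl⟩, ?_⟩
    rw [wordValue_tPower_append e hc, hs, he, ← latticeElement_mul_inr]
    exact SemidirectProduct.inl_left_mul_inr_right g

theorem exists_asyncFellowTravel_semidirectLanguage (hτ : Subgroup.zpowers τ = ⊤) :
    ∃ K : ℕ, ∀ w ∈ semidirectLanguage, ∀ w' ∈ semidirectLanguage,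
      CayleyDistLE (semidirectGen φ τ) 1 (wordValue (semidirectGen φ τ) w)
        (wordValue (semidirectGen φ τ) w') → AsyncFellowTravel (semidirectGen φ τ) K w w' := by
  obtain ⟨K₀, hK₀⟩ := exists_asyncFellowTravel_crossingLanguage (φ := φ) (τ := τ)
  obtain ⟨K₁, hK₁⟩ := exists_asyncFellowTravel_cons_t (φ := φ) (τ := τ) true
  obtain ⟨K₂, hK₂⟩ := exists_asyncFellowTravel_cons_t (φ := φ) (τ := τ) false
  have hlevel : ∀ (e e' : ℤ), ∀ c ∈ crossingLanguage, ∀ c' ∈ crossingLanguage, ∀ z : ℤ × ℤ,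
      ‖z‖ ≤ 1 → SemidirectProduct.inr (τ ^ e) * latticeElement φ (wordSum c + z) =
        SemidirectProduct.inr (τ ^ e') * latticeElement φ (wordSum c') →
      AsyncFellowTravel (semidirectGen φ τ) (K₀ + K₁ + K₂) (tPower e ++ c) (tPower e' ++ c') := by
    intro e e' c hc c' hc' z hz h
    obtain rfl := zpow_exponent_eq hτ h
    have h := latticeElement_injective (mul_left_cancel h)
    exact ((hK₀ c hc c' hc' (by simpa [← h] using hz)).mono (by omega)).append _
  have hstep : ∀ (e e' : ℤ), ∀ c ∈ crossingLanguage, ∀ c' ∈ crossingLanguage,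
      SemidirectProduct.inr (τ ^ e) * latticeElement φ (wordSum c) * SemidirectProduct.inr τ =
        SemidirectProduct.inr (τ ^ e') * latticeElement φ (wordSum c') →
      AsyncFellowTravel (semidirectGen φ τ) (K₀ + K₁ + K₂) (tPower e ++ c) (tPower e' ++ c') := by
    intro e e' c hc c' hc' h
    obtain rfl : e + 1 = e' := zpow_injective_of_zpowers_eq_top hτ (by
      simpa [latticeElement, zpow_add_one, -map_zpow] using congrArg SemidirectProduct.rightHom h)
    have h := latticeElement_mul_t h
    -- One of the two words has exactly one more letter `t` or `t⁻¹` than the other.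
    rcases le_or_gt 0 e with he | he
    · rw [tPower_add_one_of_nonneg he, List.append_assoc]
      refine AsyncFellowTravel.append ((hK₁ c hc c' hc' ?_).mono (by omega)) _
      simpa [letterValue_t] using h
    · rw [tPower_of_neg he, List.append_assoc]
      refine AsyncFellowTravel.append
        (((hK₂ c' hc' c hc ?_).mono (by omega : K₂ ≤ K₀ + K₁ + K₂)).symm) _
      rw [letterValue_t, if_neg (by simp), map_inv, mul_inv_eq_iff_eq_mul, mul_assoc, h,
        inv_mul_cancel_left]
  refine ⟨K₀ + K₁ + K₂, fun w hw w' hw' h => ?_⟩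
  obtain ⟨e, c, hc, rfl⟩ := mem_semidirectLanguage_iff_tPower.1 hw
  obtain ⟨e', c', hc', rfl⟩ := mem_semidirectLanguage_iff_tPower.1 hw'
  rw [wordValue_tPower_append e hc, wordValue_tPower_append e' hc', cayleyDistLE_one_iff] at h
  rcases h with h | ⟨⟨a, b⟩, h⟩
  · exact hlevel e e' c hc c' hc' 0 (by simp) (by simpa using h)
  · by_cases ha : a = .t
    · subst ha
      rw [letterValue_t] at h
      cases b
      · refine (hstep e' e c' hc' c hc ?_).symm
        rw [← h]
        simp
      · exact hstep e e' c hc c' hc' (by simpa using h)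
    · refine hlevel e e' c hc c' hc' _ (norm_letterStep_le (a, b)) ?_
      rw [latticeElement_add, ← mul_assoc, ← h, letterValue_eq_latticeElement ha]

end Semidirect

theorem mainTheorem7 (φ : Multiplicative ℤ →* MulAut (Multiplicative (ℤ × ℤ)))
    (τ : Multiplicative ℤ) (hτ : Subgroup.zpowers τ = ⊤) :
    IsAsynchronousCombing (semidirectGen φ τ) semidirectLanguage ∧
      IsET0L semidirectLanguage :=
  ⟨⟨inferInstance, bijOn_wordValue_semidirectLanguage hτ,
    exists_asyncFellowTravel_semidirectLanguage hτ⟩, isET0L_semidirectLanguage⟩
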